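/- Let $\Lambda^*>0$, $e\ne 0$, $M>0$ and $a$ be real numbers. In coordinates $(u,r,\theta,\phi)$ with $r>0$, $0<\theta<\pi$, put $R=r+ia\cos\theta$, $R^2=r^2+a^2\cos^2\theta$ (that is, $R\overline R$, when it appears as a real quantity) and, for a mass $m$ and a charge function $q(r)$, $\Delta^*=r^2-2mr+a^2+q^2-\Lambda^*r^4/3$. Let $g_{m,q}$ be the Kerr–Newman–de Sitter metric $$ds^2=\Big[1-\tfrac{2mr-q^2+\Lambda^*r^4/3}{R^2}\Big]du^2+2\,du\,dr+\tfrac{2a\,(2mr-q^2+\Lambda^*r^4/3)\sin^2\theta}{R^2}\,du\,d\phi-2a\sin^2\theta\,dr\,d\phi-R^2d\theta^2-\tfrac{(r^2+a^2)^2-\Delta^*a^2\sin^2\theta}{R^2}\sin^2\theta\,d\phi^2 ,$$ which for $a=0$ is the Reissner–Nordström–de Sitter metric $\{1-\frac{2m}r+\frac{q^2}{r^2}-\frac{\Lambda^*r^2}3\}du^2+2\,du\,dr-r^2(d\theta^2+\sin^2\theta\,d\phi^2)$, and let $g_{0,0}$ ($m=0$, $q=0$) be the (for $a\neq0$: rotating)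 de Sitter metric. Newman–Penrose scalars are taken in the null tetrad $\ell_a=(1,0,0,-a\sin^2\theta)$, $n_a=\big(\frac{\Delta^*}{2R^2},1,0,-\frac{\Delta^*}{2R^2}a\sin^2\theta\big)$, $m_a=-\frac1{\sqrt2 R}\big(-ia\sin\theta,\,0,\,R\overline R,\,i(r^2+a^2)\sin\theta\big)$, with $\psi_2=-C_{abcd}\ell^am^b\overline m^cn^d$, $\phi_1=\frac12F_{ab}(\ell^an^b+\overline m^am^b)$, $\Lambda=\frac1{24}R_{ab}g^{ab}$. Let $\Lambda^{(C)}$ be the scalar $\Lambda$ of the de Sitter metric and $\Lambda^{(E)}=\Lambda-\Lambda^{(C)}$ the electromagnetic Ricci scalar. An electrical radiation of the body with mass $m$ and charge $e$ is a non-constant charge function $q\in C^2(0,\infty)$ with $\Lambda^{(E)}=0$ for $g_{m,q}$ and $q(r)^2\to e^2$ as $r\to0^+$. A radiation process is an infinite sequence of masses $M_0=M,M_1,M_2,\dots$ and charge functions $q_0,q_1,\dots$ such that every $q_k$ is an electrical radiation of the body with mass $M_k$ and charge $e$, and $g_{M_k,q_k}=g_{M_{k+1},e}$ (with the constant charge $e$).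 Then: 1. For every real $m$ and every $q\in C^2(0,\infty)$, $\Lambda^{(E)}=0$ for $g_{m,q}$ if and only if $q(r)^2=2rm_1+C$ for constants $m_1,C$. For every electrical radiation $q$ of the body with any real mass $m$ there is $m_1>0$ with $q(r)^2=2rm_1+e^2$ and $g_{m,q}=g_{m-m_1,e}$. For every sequence of positive numbers $m_1,m_2,\dots$ there is a radiation process with $M_k=M-(m_1+\dots+m_k)$ for all $k$. 2. In every radiation process the masses strictly decrease. If the mass has evaporated completely after $N$ radiations, $M_N=0$, then after $n\ge1$ further radiations the metric is $$ds^2=\Big[1+\tfrac{2r\mathcal M^*+e^2-\Lambda^*r^4/3}{R^2}\Big]du^2+2\,du\,dr-\tfrac{2a(2r\mathcal M^*+e^2-\Lambda^*r^4/3)\sin^2\theta}{R^2}\,du\,d\phi-2a\sin^2\theta\,dr\,d\phi-R^2d\theta^2-\tfrac{(r^2+a^2)^2-\Delta^*a^2\sin^2\theta}{R^2}\sin^2\theta\,d\phi^2,$$ $\Delta^*=r^2+2r\mathcal M^*+a^2+e^2-\Lambda^*r^4/3$, where $\mathcal M^*=m_1^*+\dots+m_n^*>0$ and $m_j^*=M_{N+j-1}-M_{N+j}$;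 if the series $\sum_j m_j^*$ converges, to $\mathcal M^*$, then $\mathcal M^*>0$ and the metrics converge pointwise to this metric as $n\to\infty$. For $a=0$ the metric is $$ds^2=\Big(1+\tfrac{2\mathcal M^*}r+\tfrac{e^2}{r^2}-\tfrac{\Lambda^*r^2}3\Big)du^2+2\,du\,dr-r^2(d\theta^2+\sin^2\theta\,d\phi^2).$$ 3. The Maxwell scalar and $\Lambda^{(C)}$ do not change: there is a single smooth 2-form $F$ such that for every real mass $m$ (positive, zero or negative) $F$ satisfies the source-free Maxwell equations for $g_{m,e}$, its Newman–Penrose components are $\phi_0=\phi_2=0$, $\phi_1=\dfrac{e}{\sqrt2\,\overline R\,\overline R}$, Einstein's equations $R_{ab}-\frac12\mathcal{R}\,g_{ab}=-(T^{(E)}_{ab}+T^{(C)}_{ab})$ hold ($\mathcal R$ the scalar curvature, $T^{(E)}_{ab}=\frac14g_{ab}F_{cd}F^{cd}-F_{ac}F_b{}^c$, $T^{(C)}_{ab}=2\{\rho\,\ell_{(a}n_{b)}+p\,m_{(a}\overline m_{b)}\}$, $\rho=\Lambda^*r^4/(R\overline R)^2$, $p=-\Lambda^*r^2(r^2+2a^2\cos^2\theta)/(R\overline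 R)^2$), and $\Lambda=\Lambda^{(C)}=\Lambda^*r^2/(6R\overline R)$. 4. For every $\mathcal M^*>0$ the metric in 2 is $g_{-\mathcal M^*,e}$ and has $$\psi_2=\frac1{\overline R\,\overline R\,(R\overline R)}\Big\{\mathcal M^*R+e^2+\frac{\Lambda^*r^2}3a^2\cos^2\theta\Big\},\qquad\text{for }a=0:\quad \psi_2=\frac{\mathcal M^*}{r^3}\Big(1+\frac{e^2}{r\mathcal M^*}\Big).$$ It is a negative mass naked singularity embedded into the de Sitter metric, in the following sense. (i) The curvature invariant $R_{ab}R^{ab}$ tends to $\infty$ as $r^2+a^2\cos^2\theta\to0$. (ii) There is exactly one $r_c>0$ for which the hypersurface $r=r_c$ is null (the cosmological horizon); the hypersurfaces $r=\mathrm{const}$ are timelike for $0<r<r_c$ and spacelike for $r>r_c$, so no horizon encloses the singularity. (iii) The equatorial rays $s\mapsto(u,s,\pi/2,\phi)$, $s>0$, are affinely parametrized null geodesics which emanate from the singularity ($R_{ab}R^{ab}\to\infty$ as $s\to0^+$) and reach every value of $r$. (iv) The metric has the Kerr–Schild form $g_{ab}=g^{dS}_{ab}+2Q\,\ell_a\ell_b$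 over the de Sitter metric with $Q=-(rm-e^2/2)/R^2$ for the negative mass $m=-\mathcal M^*$, and $\ell$ is null for both metrics. -/

import Mathlib

open Filter Topology

noncomputable section

/-! ### Semi-Riemannian geometry in one coordinate chart -/

/-- A coordinate point; the coordinates are `(u, r, θ, φ) = (x 0, x 1, x 2, x 3)`. -/
abbrev Event := Fin 4 → ℝ

/-- A field of covariant 2-tensors given by its components in the coordinates. -/
abbrev TensorField2 := Event → Matrix (Fin 4) (Fin 4) ℝ

/-- Partial derivative `∂ᵢ f` at `x`. -/
def pderivAt (i : Fin 4) (f : Event → ℝ) (x : Event) : ℝ :=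
  deriv (fun t => f (Function.update x i t)) (x i)

/-- Christoffel symbol `Γᵃ_{bc}` of the Levi-Civita connection of `g`. -/
def christoffel (g : TensorField2) (a b c : Fin 4) (x : Event) : ℝ :=
  (1 / 2) * ∑ d, (g x)⁻¹ a d *
    (pderivAt b (fun y => g y d c) x + pderivAt c (fun y => g y d b) x
      - pderivAt d (fun y => g y b c) x)

/-- Riemann tensor
`Rᵃ_{bcd} = ∂_c Γᵃ_{db} - ∂_d Γᵃ_{cb} + Γᵃ_{ce} Γᵉ_{db} - Γᵃ_{de} Γᵉ_{cb}`. -/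
def riemannUp (g : TensorField2) (a b c d : Fin 4) (x : Event) : ℝ :=
  pderivAt c (christoffel g a d b) x - pderivAt d (christoffel g a c b) x
    + ∑ e, (christoffel g a c e x * christoffel g e d b x
      - christoffel g a d e x * christoffel g e c b x)

/-- `R_{abcd}`. -/
def riemannLow (g : TensorField2) (a b c d : Fin 4) (x : Event) : ℝ :=
  ∑ e, g x a e * riemannUp g e b c d x

/-- Ricci tensor, with the sign convention `R_{bc} = Rᵃ_{bca}`. In signature `(+,-,-,-)`, which is
used throughout, this makes the scalar curvature of the de Sitter space with cosmological constant
`Λ` equal to `4 Λ`. -/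
def ricciTensor (g : TensorField2) (b c : Fin 4) (x : Event) : ℝ :=
  ∑ a, riemannUp g a b c a x

/-- Scalar curvature `R_{ab} g^{ab}`. -/
def scalarCurv (g : TensorField2) (x : Event) : ℝ :=
  ∑ a, ∑ b, (g x)⁻¹ a b * ricciTensor g a b x

/-- Weyl tensor `C_{abcd}`: the trace-free part of `R_{abcd}` (for `R_{bc} = g^{ad} R_{abcd}`). -/
def weylTensor (g : TensorField2) (a b c d : Fin 4) (x : Event) : ℝ :=
  riemannLow g a b c d x
    + (1 / 2) * (g x a c * ricciTensor g b d x - g x a d * ricciTensor g b c x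
        - g x b c * ricciTensor g a d x + g x b d * ricciTensor g a c x)
    - scalarCurv g x / 6 * (g x a c * g x b d - g x a d * g x b c)

/-- The scalar curvature invariant `R_{ab} R^{ab}`. -/
def ricciSquared (g : TensorField2) (x : Event) : ℝ :=
  ∑ a, ∑ b, ∑ c, ∑ d,
    (g x)⁻¹ a c * (g x)⁻¹ b d * ricciTensor g a b x * ricciTensor g c d x

/-- Einstein tensor `R_{ab} - (1/2) R g_{ab}`. -/
def einsteinTensor (g : TensorField2) (a b : Fin 4) (x : Event) : ℝ :=
  ricciTensor g a b x - (1 / 2) * scalarCurv g x * g x a b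

/-- `γ`, restricted to the open parameter set `S`, is an affinely parametrized null geodesic
of `g`. -/
structure IsNullGeodesicOn (g : TensorField2) (γ : ℝ → Event) (S : Set ℝ) : Prop where
  smooth : ContDiffOn ℝ 2 γ S
  regular : ∀ s ∈ S, deriv γ s ≠ 0
  null : ∀ s ∈ S, ∑ a, ∑ b, g (γ s) a b * deriv γ s a * deriv γ s b = 0
  geodesic : ∀ s ∈ S, ∀ a, deriv (deriv γ) s a
    + ∑ b, ∑ c, christoffel g a b c (γ s) * deriv γ s b * deriv γ s c = 0

/-! ### Newman-Penrose scalars -/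

/-- Raise the index of a complex covector with `g`. -/
def raiseIndex (g : TensorField2) (x : Event) (v : Fin 4 → ℂ) (a : Fin 4) : ℂ :=
  ∑ b, (((g x)⁻¹ a b : ℝ) : ℂ) * v b

/-- Complex conjugate of a covector. -/
def conjCovector (v : Fin 4 → ℂ) (a : Fin 4) : ℂ := starRingEnd ℂ (v a)

/-- `Λ = R_{ab} g^{ab} / 24`. -/
def npLambda (g : TensorField2) (x : Event) : ℝ := (1 / 24) * scalarCurv g x

/-- `ψ₂ = - C_{abcd} ℓᵃ mᵇ m̄ᶜ nᵈ` for the null tetrad with covectors `ℓ, n, m, m̄` at `x`. -/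
def npPsi2 (g : TensorField2) (l n m : Fin 4 → ℂ) (x : Event) : ℂ :=
  - ∑ a, ∑ b, ∑ c, ∑ d, ((weylTensor g a b c d x : ℝ) : ℂ) *
      raiseIndex g x l a * raiseIndex g x m b *
      raiseIndex g x (conjCovector m) c * raiseIndex g x n d

/-- `φ₀ = F_{ab} ℓᵃ mᵇ`. -/
def npPhi0 (g F : TensorField2) (l m : Fin 4 → ℂ) (x : Event) : ℂ :=
  ∑ a, ∑ b, ((F x a b : ℝ) : ℂ) * raiseIndex g x l a * raiseIndex g x m b

/-- Maxwell scalar `φ₁ = (1/2) F_{ab} (ℓᵃ nᵇ + m̄ᵃ mᵇ)`. -/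
def npPhi1 (g F : TensorField2) (l n m : Fin 4 → ℂ) (x : Event) : ℂ :=
  (1 / 2) * ∑ a, ∑ b, ((F x a b : ℝ) : ℂ) *
    (raiseIndex g x l a * raiseIndex g x n b
      + raiseIndex g x (conjCovector m) a * raiseIndex g x m b)

/-- `φ₂ = F_{ab} m̄ᵃ nᵇ`. -/
def npPhi2 (g F : TensorField2) (n m : Fin 4 → ℂ) (x : Event) : ℂ :=
  ∑ a, ∑ b, ((F x a b : ℝ) : ℂ) * raiseIndex g x (conjCovector m) a * raiseIndex g x n b

/-- `F` is a smooth solution of the source-free Maxwell equations `dF = 0`, `∇ᵃ F_{ab} = 0`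
for the metric `g` on the open set `U`. -/
structure IsMaxwellFieldOn (g F : TensorField2) (U : Set Event) : Prop where
  smooth : ∀ a b, ContDiffOn ℝ (⊤ : ℕ∞) (fun x => F x a b) U
  antisymm : ∀ x ∈ U, ∀ a b, F x b a = - F x a b
  closed : ∀ x ∈ U, ∀ a b c, pderivAt a (fun y => F y b c) x + pderivAt b (fun y => F y c a) x
    + pderivAt c (fun y => F y a b) x = 0
  divergence_free : ∀ x ∈ U, ∀ b, ∑ a, ∑ c, (g x)⁻¹ a c *
    (pderivAt c (fun y => F y a b) x - ∑ d, christoffel g d c a x * F x d b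
      - ∑ d, christoffel g d c b x * F x a d) = 0

/-- Energy-momentum tensor `(1/4) g_{ab} F_{cd} F^{cd} - F_{ac} F_b{}^c` of `F`. -/
def maxwellStress (g F : TensorField2) (a b : Fin 4) (x : Event) : ℝ :=
  (1 / 4) * g x a b * (∑ c, ∑ d, ∑ p, ∑ q, (g x)⁻¹ c p * (g x)⁻¹ d q * F x c d * F x p q)
    - ∑ c, ∑ d, (g x)⁻¹ c d * F x a c * F x b d

/-! ### The metrics -/

/-- The coordinate domain `r > 0`, `0 < θ < π`. -/
def coordDomain : Set Event := {x | 0 < x 1 ∧ 0 < x 2 ∧ x 2 < Real.pi}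

/-- `R² = r² + a² cos² θ`. -/
def Rsq (a : ℝ) (x : Event) : ℝ := x 1 ^ 2 + a ^ 2 * Real.cos (x 2) ^ 2

/-- The complex `R = r + i a cos θ`. -/
def Rcx (a : ℝ) (x : Event) : ℂ := (x 1 : ℂ) + Complex.I * (a : ℂ) * (Real.cos (x 2) : ℂ)

/-- `Δ* = r² - 2 M r + a² + q(r)² - Λ r⁴ / 3`. -/
def DeltaStar (a Λ M : ℝ) (q : ℝ → ℝ) (x : Event) : ℝ :=
  x 1 ^ 2 - 2 * M * x 1 + a ^ 2 + q (x 1) ^ 2 - Λ * x 1 ^ 4 / 3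

/-- The Kerr-Newman-de Sitter metric with mass `M`, rotation parameter `a`, cosmological
constant `Λ` and variable charge `q(r)`. -/
def kndsMetric (a Λ M : ℝ) (q : ℝ → ℝ) : TensorField2 := fun x =>
  let r := x 1
  let s2 := Real.sin (x 2) ^ 2
  let P := (2 * M * r - q r ^ 2 + Λ * r ^ 4 / 3) / Rsq a x
  !![1 - P,      1,       0,          a * P * s2;
     1,          0,       0,          - a * s2;
     0,          0,       - Rsq a x,  0;
     a * P * s2, - a * s2, 0,
       - ((r ^ 2 + a ^ 2) ^ 2 - DeltaStar a Λ M q x * a ^ 2 * s2) / Rsq a x * s2]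

/-- The Reissner-Nordstrom-de Sitter metric with mass `M` and variable charge `q(r)`:
`(1 - 2M/r + q²/r² - Λr²/3) du² + 2 du dr - r² (dθ² + sin²θ dφ²)`. -/
def rndsMetric (Λ M : ℝ) (q : ℝ → ℝ) : TensorField2 := fun x =>
  let r := x 1
  !![1 - 2 * M / r + q r ^ 2 / r ^ 2 - Λ * r ^ 2 / 3, 1, 0, 0;
     1, 0, 0, 0;
     0, 0, - r ^ 2, 0;
     0, 0, 0, - r ^ 2 * Real.sin (x 2) ^ 2]

/-- The (for `a ≠ 0`: rotating) de Sitter metric. -/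
def deSitterMetric (a Λ : ℝ) : TensorField2 := kndsMetric a Λ 0 (fun _ => 0)

/-- The rotating metric with new mass `μ` (mass term `-μ`) and constant charge `e`. -/
def negMassMetric (a Λ μ e : ℝ) : TensorField2 := fun x =>
  let r := x 1
  let s2 := Real.sin (x 2) ^ 2
  let P := (2 * r * μ + e ^ 2 - Λ * r ^ 4 / 3) / Rsq a x
  let Δ := r ^ 2 + 2 * r * μ + a ^ 2 + e ^ 2 - Λ * r ^ 4 / 3
  !![1 + P,        1,       0,          - a * P * s2;
     1,            0,       0,          - a * s2;
     0,            0,       - Rsq a x,  0;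
     - a * P * s2, - a * s2, 0,
       - ((r ^ 2 + a ^ 2) ^ 2 - Δ * a ^ 2 * s2) / Rsq a x * s2]

/-- The non-rotating metric with new mass `μ` and constant charge `e`:
`(1 + 2μ/r + e²/r² - Λr²/3) du² + 2 du dr - r² (dθ² + sin²θ dφ²)`. -/
def negMassRNMetric (Λ μ e : ℝ) : TensorField2 := fun x =>
  let r := x 1
  !![1 + 2 * μ / r + e ^ 2 / r ^ 2 - Λ * r ^ 2 / 3, 1, 0, 0;
     1, 0, 0, 0;
     0, 0, - r ^ 2, 0;
     0, 0, 0, - r ^ 2 * Real.sin (x 2) ^ 2]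

/-- The covector `ℓ` of the null tetrad. -/
def tetradL (a : ℝ) (x : Event) : Fin 4 → ℂ :=
  ![1, 0, 0, - (a : ℂ) * (Real.sin (x 2) : ℂ) ^ 2]

/-- The covector `n` of the null tetrad. -/
def tetradN (a Λ M : ℝ) (q : ℝ → ℝ) (x : Event) : Fin 4 → ℂ :=
  let h : ℂ := ((DeltaStar a Λ M q x / (2 * Rsq a x) : ℝ) : ℂ)
  ![h, 1, 0, - h * (a : ℂ) * (Real.sin (x 2) : ℂ) ^ 2]

/-- The covector `m` of the null tetrad. -/
def tetradM (a : ℝ) (x : Event) : Fin 4 → ℂ :=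
  let k : ℂ := - 1 / ((Real.sqrt 2 : ℂ) * Rcx a x)
  ![- k * Complex.I * (a : ℂ) * (Real.sin (x 2) : ℂ), 0, k * (Rsq a x : ℂ),
    k * Complex.I * ((x 1 : ℂ) ^ 2 + (a : ℂ) ^ 2) * (Real.sin (x 2) : ℂ)]

/-- Energy-momentum tensor `2 {ρ ℓ_(a n_b) + p m_(a m̄_b)}` of the cosmological matter, with
`ρ = Λ r⁴ / R⁴` and `p = - Λ r² (r² + 2 a² cos² θ) / R⁴`; it is `Λ g_{ab}` if `a = 0`. -/
def cosmologicalStress (a Λ M : ℝ) (q : ℝ → ℝ) (i j : Fin 4) (x : Event) : ℂ :=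
  let l := tetradL a x
  let n := tetradN a Λ M q x
  let m := tetradM a x
  let ρ : ℂ := ((Λ * x 1 ^ 4 / Rsq a x ^ 2 : ℝ) : ℂ)
  let p : ℂ :=
    ((- Λ * x 1 ^ 2 * (x 1 ^ 2 + 2 * a ^ 2 * Real.cos (x 2) ^ 2) / Rsq a x ^ 2 : ℝ) : ℂ)
  2 * (ρ * ((l i * n j + l j * n i) / 2)
    + p * ((m i * conjCovector m j + m j * conjCovector m i) / 2))

/-! ### Electrical radiation -/

/-- The cosmological Ricci scalar `Λ^(C)`: the scalar `Λ` of the de Sitter metric. -/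
def lambdaC (a Λ : ℝ) (x : Event) : ℝ := npLambda (deSitterMetric a Λ) x

/-- The electromagnetic Ricci scalar `Λ^(E) = Λ - Λ^(C)` of the metric with mass `M` and variable
charge `q`. -/
def lambdaE (a Λ M : ℝ) (q : ℝ → ℝ) (x : Event) : ℝ :=
  npLambda (kndsMetric a Λ M q) x - lambdaC a Λ x

/-- The variable charge `q(r)` is an electrical radiation of the body with mass `M` and charge `e`:
it really varies, the Ricci scalar of the electromagnetic field vanishes, and the constant term of
`q(r)²` (its value at `r = 0`) is identified with `e²`. -/
structure IsElectricalRadiation (a Λ e M : ℝ) (q : ℝ → ℝ) : Prop where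
  smooth : ContDiffOn ℝ 2 q (Set.Ioi 0)
  variable_charge : ¬ ∃ c, ∀ r, 0 < r → q r = c
  lambdaE_eq_zero : ∀ x ∈ coordDomain, lambdaE a Λ M q x = 0
  charge : Tendsto (fun r => q r ^ 2) (𝓝[>] 0) (𝓝 (e ^ 2))

/-- An unending sequence of electrical radiations of a body with charge `e` and initial mass `M`:
`mass k` is the mass after `k` radiations, `q k` is the variable charge in the radiation that
follows, and this radiation turns the metric into the one with mass `mass (k + 1)` and constant
charge `e`. -/
structure IsRadiationProcess (a Λ e M : ℝ) (mass : ℕ → ℝ) (q : ℕ → ℝ → ℝ) : Prop where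
  init : mass 0 = M
  radiation : ∀ k, IsElectricalRadiation a Λ e (mass k) (q k)
  next : ∀ k, ∀ x ∈ coordDomain,
    kndsMetric a Λ (mass k) (q k) x = kndsMetric a Λ (mass (k + 1)) (fun _ => e) x

/-! ### Naked singularities -/

/-- The metric `g` on the coordinate domain has a naked singularity at `R² = r² + a² cos² θ = 0`. -/
structure IsNakedSingularity (a : ℝ) (g : TensorField2) : Prop where
  /-- Curvature singularity: the invariant `R_{ab} R^{ab}` tends to infinity as `R² → 0`. -/
  curvature_blowup :
    Tendsto (ricciSquared g) (comap (Rsq a) (𝓝 0) ⊓ 𝓟 coordDomain) atTop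
  /-- No horizon encloses it: the only null hypersurface `r = const` (where `g^{rr} = 0`) is a
  cosmological horizon `r = r_c`, and `r = const` is timelike for all `r < r_c`. -/
  exposed : ∃ rc : ℝ, 0 < rc ∧ ∀ x ∈ coordDomain,
    (x 1 < rc → (g x)⁻¹ 1 1 < 0) ∧ (x 1 = rc → (g x)⁻¹ 1 1 = 0) ∧ (rc < x 1 → 0 < (g x)⁻¹ 1 1)
  /-- It is visible: the equatorial rays `s ↦ (u, s, π/2, φ)`, `s > 0`, are null geodesics that
  start at it and reach every `r`. -/
  visible : ∀ u φ : ℝ, IsNullGeodesicOn g (fun s => ![u, s, Real.pi / 2, φ]) (Set.Ioi 0) ∧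
    Tendsto (fun s : ℝ => ricciSquared g ![u, s, Real.pi / 2, φ]) (𝓝[>] 0) atTop

/-- `g` is the metric of a body of mass `m` and charge `e` embedded into the de Sitter metric, in
Kerr-Schild form `g = g^{dS} + 2 Q ℓ ⊗ ℓ` with `Q = - (r m - e² / 2) / R²` and `ℓ` null
for both metrics. -/
def IsEmbeddedInDeSitter (a Λ m e : ℝ) (g : TensorField2) : Prop :=
  ∀ x ∈ coordDomain,
    (∀ i j, ((g x i j : ℝ) : ℂ) = ((deSitterMetric a Λ x i j : ℝ) : ℂ)
      + 2 * ((- (x 1 * m - e ^ 2 / 2) / Rsq a x : ℝ) : ℂ) * tetradL a x i * tetradL a x j) ∧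
    (∑ i, raiseIndex g x (tetradL a x) i * tetradL a x i = 0) ∧
    (∑ i, raiseIndex (deSitterMetric a Λ) x (tetradL a x) i * tetradL a x i = 0)

end

noncomputable section

/-! ### Partial derivatives of stationary axisymmetric functions -/

/-! Mass, charge and cosmological constant enter the metric only through the profile `w(r) = 2mr -
q² + Λr⁴/3` of a Kerr–Schild metric `η - (w/R²) ℓ ⊗ ℓ`, whose covector ℓ is null and has `ℓᵃ = ∂_r`
for every profile. The curvature is therefore computed once, for an arbitrary twice differentiable
`w`. The components are tables of polynomials in `r`, `s = sin θ`, `c = cos θ`, `z = 1/R²`, `t =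
1/sin θ`, `w`, `w'`, `w''`, and each tensor identity becomes an identity of rational functions
modulo `zR² = 1`, `ts = 1`, `c² = 1 - s²`.

The scalar curvature is `w''/R²` (`scalarCurv_ksMetric`). Subtracting the de Sitter value leaves
`Λ^(E) = -(q²)''/(24R²)` (`lambdaE_eq`), which vanishes exactly when `q²` is affine in `r`. The
limit at `r = 0` fixes the constant term `e²`; since `q² ≥ 0` for large `r` and `q` is not constant,
the slope `2m₁` is positive (`IsElectricalRadiation.exists_mass`). Inserting `q² = 2rm₁ + e²` in `w`
only replaces `m` by `m - m₁`, so masses decrease at each step, through zero as well, and the choice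
`q = √(2rm₁ + e²)` realizes any positive `m₁`.

The field tensor contains no `w` and solves Maxwell's equations on every Kerr–Schild background
(`isMaxwellFieldOn_faradayField`). The mass term `2mr` has zero second derivative and cancels in `w
- rw' = -(e² + Λr⁴)`; hence it is invisible to the scalar Λ and to the coefficients of `ℓ ⊗ n + n ⊗
ℓ` and `g` in Einstein's equations (`einstein_ksMetric`).

The same cancellation bounds `R_{ab}R^{ab}` below by `2e⁴/R⁸`, whence the singularity. For mass `-μ
< 0`, `Δ*/r² = 1 + 2μ/r + (a² + e²)/r² - Λr²/3` is strictly decreasing, so there is just one horizon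
(`exists_horizon`). The rays are geodesics because `g_{rr} = 0` and `Γᵃ_{rr} = 0`. -/

theorem isOpen_coordDomain : IsOpen coordDomain :=
  (isOpen_lt continuous_const (continuous_apply 1)).inter
    ((isOpen_lt continuous_const (continuous_apply 2)).inter
      (isOpen_lt (continuous_apply 2) continuous_const))

theorem coordDomain_mem_nhds {x : Event} (hx : x ∈ coordDomain) : coordDomain ∈ 𝓝 x :=
  isOpen_coordDomain.mem_nhds hx

theorem tendsto_update_self (x : Event) (i : Fin 4) :
    Tendsto (fun t => Function.update x i t) (𝓝 (x i)) (𝓝 x) := by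
  have h : Continuous fun t => Function.update x i t := continuous_const.update i continuous_id
  simpa using h.tendsto (x i)

/-- The partial derivatives of a function which near `x` depends on `r` and `θ` only. -/
theorem pderivAt_of_hasDerivAt {f : Event → ℝ} {F : ℝ → ℝ → ℝ} {Fr Ft : ℝ} {x : Event}
    (h : ∀ᶠ y in 𝓝 x, f y = F (y 1) (y 2))
    (hr : HasDerivAt (fun ρ => F ρ (x 2)) Fr (x 1))
    (ht : HasDerivAt (fun ϑ => F (x 1) ϑ) Ft (x 2)) (i : Fin 4) :
    pderivAt i f x = (![0, Fr, Ft, 0] : Fin 4 → ℝ) i := by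
  have key : (fun t => f (Function.update x i t)) =ᶠ[𝓝 (x i)]
      fun t => F (Function.update x i t 1) (Function.update x i t 2) :=
    (tendsto_update_self x i).eventually h
  rw [pderivAt, key.deriv_eq]
  fin_cases i
  · simp
  · simpa [Function.update_apply] using hr.deriv
  · simpa [Function.update_apply] using ht.deriv
  · simp

theorem Rsq_pos {a : ℝ} {x : Event} (hx : x ∈ coordDomain) : 0 < Rsq a x := by
  have := hx.1
  unfold Rsq
  positivity

theorem sin_pos_of_mem {x : Event} (hx : x ∈ coordDomain) : 0 < Real.sin (x 2) :=
  Real.sin_pos_of_pos_of_lt_pi hx.2.1 hx.2.2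

/-! ### The Kerr-Schild metric with an arbitrary profile -/

/-- The metric `η - (w(r) / R²) ℓ ⊗ ℓ`, where `η` is the flat metric in rotating coordinates. -/
def ksMetric (a : ℝ) (w : ℝ → ℝ) : TensorField2 := fun x =>
  let r := x 1
  let s2 := Real.sin (x 2) ^ 2
  let P := w r / Rsq a x
  !![1 - P,      1,       0,          a * P * s2;
     1,          0,       0,          - a * s2;
     0,          0,       - Rsq a x,  0;
     a * P * s2, - a * s2, 0,
       - ((r ^ 2 + a ^ 2) ^ 2 - (r ^ 2 + a ^ 2 - w r) * a ^ 2 * s2) / Rsq a x * s2]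

/-- Reduces every metric considered here to a single function of `r`, so that all curvature
computations can be shared. -/
theorem kndsMetric_eq_ksMetric (a Λ M : ℝ) (q : ℝ → ℝ) :
    kndsMetric a Λ M q = ksMetric a (fun r => 2 * M * r - q r ^ 2 + Λ * r ^ 4 / 3) := by
  funext x
  have h : DeltaStar a Λ M q x
      = x 1 ^ 2 + a ^ 2 - (2 * M * x 1 - q (x 1) ^ 2 + Λ * x 1 ^ 4 / 3) := by
    unfold DeltaStar
    ring
  simp only [kndsMetric, ksMetric, h]

/-- The components of the Kerr-Schild metric, with `s = sin θ`, `c = cos θ`, `z = 1 / R²`. -/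
def metricTable (a r s c z w : ℝ) : Matrix (Fin 4) (Fin 4) ℝ :=
  !![1 - w * z, 1, 0, a * (w * z) * s ^ 2;
     1, 0, 0, - a * s ^ 2;
     0, 0, - (r ^ 2 + a ^ 2 * c ^ 2), 0;
     a * (w * z) * s ^ 2, - a * s ^ 2, 0, - (r ^ 2 + a ^ 2) * s ^ 2 - w * z * a ^ 2 * s ^ 4]

/-- The `r`-derivatives of `metricTable`. -/
def metricTableR (a r s z w v : ℝ) : Matrix (Fin 4) (Fin 4) ℝ :=
  let k := v * z / 2 - r * w * z ^ 2
  !![- 2 * k, 0, 0, 2 * a * k * s ^ 2;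
     0, 0, 0, 0;
     0, 0, - 2 * r, 0;
     2 * a * k * s ^ 2, 0, 0, - 2 * r * s ^ 2 - 2 * k * a ^ 2 * s ^ 4]

/-- The `θ`-derivatives of `metricTable`. -/
def metricTableTheta (a r s c z w : ℝ) : Matrix (Fin 4) (Fin 4) ℝ :=
  let h := 2 * a ^ 2 * s * c * w * z ^ 2
  !![- h, 0, 0, a * h * s ^ 2 + 2 * a * w * z * s * c;
     0, 0, 0, - 2 * a * s * c;
     0, 0, 2 * a ^ 2 * s * c, 0;
     a * h * s ^ 2 + 2 * a * w * z * s * c, - 2 * a * s * c, 0,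
       - 2 * (r ^ 2 + a ^ 2) * s * c - h * a ^ 2 * s ^ 4 - 4 * w * z * a ^ 2 * s ^ 3 * c]

/-- The inverse of the Kerr-Schild metric, with `t = 1 / sin θ`. -/
def inverseTable (a r s t z w : ℝ) : Matrix (Fin 4) (Fin 4) ℝ :=
  !![- a ^ 2 * s ^ 2 * z, (r ^ 2 + a ^ 2) * z, 0, - a * z;
     (r ^ 2 + a ^ 2) * z, - (r ^ 2 + a ^ 2 - w) * z, 0, a * z;
     0, 0, - z, 0;
     - a * z, a * z, 0, - z * t ^ 2]

/-- The symmetric `4 × 4` matrix with the given upper triangle. -/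
def symmMatrix (a₀₀ a₀₁ a₀₂ a₀₃ a₁₁ a₁₂ a₁₃ a₂₂ a₂₃ a₃₃ : ℝ) : Matrix (Fin 4) (Fin 4) ℝ :=
  !![a₀₀, a₀₁, a₀₂, a₀₃; a₀₁, a₁₁, a₁₂, a₁₃; a₀₂, a₁₂, a₂₂, a₂₃; a₀₃, a₁₃, a₂₃, a₃₃]

/-- The Christoffel symbols `Γᵃ_{bc}` of the Kerr-Schild metric, where `s = sin θ`, `c = cos θ`,
`t = 1 / sin θ`, `z = 1 / R²`, and `w`, `v` are the profile and its derivative. -/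
def gammaTable (a r s c t z w v : ℝ) : Fin 4 → Matrix (Fin 4) (Fin 4) ℝ :=
  let R := r ^ 2 + a ^ 2
  let D := R - w
  let k := v * z / 2 - r * w * z ^ 2
  let A := k * z
  let U := w * z ^ 2
  let Y := w * z ^ 3
  ![ symmMatrix (R * A) 0 (-a ^ 2 * s * c * U) (-a * s ^ 2 * R * A)
      0 (a ^ 2 * s * c * z) (a * r * s ^ 2 * z)
      (r * R * z) (a ^ 3 * s ^ 3 * c * U)
      (a ^ 2 * s ^ 4 * R * A + r * s ^ 2 * R * z),
     symmMatrix (-D * A) (-k) 0 (a * s ^ 2 * D * A)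
      0 (-a ^ 2 * s * c * z) (-a * r * s ^ 2 * z + a * s ^ 2 * k)
      (-r * D * z) 0
      (-a ^ 2 * s ^ 4 * D * A - r * s ^ 2 * D * z),
     symmMatrix (-a ^ 2 * s * c * Y) 0 0 (a * s * c * R * Y)
      0 (r * z) (-a * s * c * z)
      (-a ^ 2 * s * c * z) 0
      (-a ^ 2 * s ^ 3 * c * R * Y - a ^ 2 * s ^ 3 * c * U - s * c * R * z),
     symmMatrix (a * A) 0 (-a * c * t * U) (-a ^ 2 * s ^ 2 * A)
      0 (a * c * t * z) (r * z)
      (a * r * z) (a ^ 2 * s * c * U + c * t)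
      (a ^ 3 * s ^ 4 * A + a * r * s ^ 2 * z)]

/-- The `r`-derivatives of `gammaTable`; `x` is the second derivative of the profile. -/
def gammaTableR (a r s c t z w v x : ℝ) : Fin 4 → Matrix (Fin 4) (Fin 4) ℝ :=
  let R := r ^ 2 + a ^ 2
  let D := R - w
  let k := v * z / 2 - r * w * z ^ 2
  let A := k * z
  let Y := w * z ^ 3
  let zr := -2 * r * z ^ 2
  let kr := x * z / 2 + v * zr / 2 - w * z ^ 2 - r * v * z ^ 2 - 2 * r * w * z * zr
  let Ar := kr * z + k * zr
  let Ur := v * z ^ 2 + 2 * w * z * zr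
  let Yr := v * z ^ 3 + 3 * w * z ^ 2 * zr
  ![ symmMatrix (2 * r * A + R * Ar) 0 (-a ^ 2 * s * c * Ur) (-2 * a * r * s ^ 2 * A - a * s ^ 2 * R * Ar)
      0 (a ^ 2 * s * c * zr) (a * r * s ^ 2 * zr + a * s ^ 2 * z)
      (2 * r ^ 2 * z + r * R * zr + R * z) (a ^ 3 * s ^ 3 * c * Ur)
      (2 * a ^ 2 * r * s ^ 4 * A + a ^ 2 * s ^ 4 * R * Ar + 2 * r ^ 2 * s ^ 2 * z + r * s ^ 2 * R
        * zr + s ^ 2 * R * z),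
     symmMatrix (-2 * r * A - D * Ar + A * v) (-kr) 0 (2 * a * r * s ^ 2 * A + a * s ^ 2 * D * Ar - a * s ^
        2 * A * v)
      0 (-a ^ 2 * s * c * zr) (-a * r * s ^ 2 * zr - a * s ^ 2 * z + a * s ^ 2 * kr)
      (-2 * r ^ 2 * z - r * D * zr + r * z * v - D * z) 0
      (-2 * a ^ 2 * r * s ^ 4 * A - a ^ 2 * s ^ 4 * D * Ar + a ^ 2 * s ^ 4 * A * v - 2 * r ^ 2 *
        s ^ 2 * z - r * s ^ 2 * D * zr + r * s ^ 2 * z * v - s ^ 2 * D * z),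
     symmMatrix (-a ^ 2 * s * c * Yr) 0 0 (2 * a * r * s * c * Y + a * s * c * R * Yr)
      0 (r * zr + z) (-a * s * c * zr)
      (-a ^ 2 * s * c * zr) 0
      (-2 * a ^ 2 * r * s ^ 3 * c * Y - a ^ 2 * s ^ 3 * c * R * Yr - a ^ 2 * s ^ 3 * c * Ur - 2 *
        r * s * c * z - s * c * R * zr),
     symmMatrix (a * Ar) 0 (-a * c * t * Ur) (-a ^ 2 * s ^ 2 * Ar)
      0 (a * c * t * zr) (r * zr + z)
      (a * r * zr + a * z) (a ^ 2 * s * c * Ur)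
      (a ^ 3 * s ^ 4 * Ar + a * r * s ^ 2 * zr + a * s ^ 2 * z)]

/-- The `θ`-derivatives of `gammaTable`. -/
def gammaTableTheta (a r s c t z w v : ℝ) : Fin 4 → Matrix (Fin 4) (Fin 4) ℝ :=
  let R := r ^ 2 + a ^ 2
  let D := R - w
  let k := v * z / 2 - r * w * z ^ 2
  let A := k * z
  let U := w * z ^ 2
  let Y := w * z ^ 3
  let zt := 2 * a ^ 2 * s * c * z ^ 2
  let kt := v * zt / 2 - 2 * r * w * z * zt
  let At := kt * z + k * zt
  let Ut := 2 * w * z * zt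
  let Yt := 3 * w * z ^ 2 * zt
  ![ symmMatrix (R * At) 0 (a ^ 2 * s ^ 2 * U - a ^ 2 * s * c * Ut - a ^ 2 * c ^ 2 * U) (-a * s ^ 2 * R *
        At - 2 * a * s * c * R * A)
      0 (-a ^ 2 * s ^ 2 * z + a ^ 2 * s * c * zt + a ^ 2 * c ^ 2 * z) (a * r * s ^ 2 * zt + 2 * a
        * r * s * c * z)
      (r * R * zt) (-a ^ 3 * s ^ 4 * U + a ^ 3 * s ^ 3 * c * Ut + 3 * a ^ 3 * s ^ 2 * c ^ 2 * U)
      (a ^ 2 * s ^ 4 * R * At + 4 * a ^ 2 * s ^ 3 * c * R * A + r * s ^ 2 * R * zt + 2 * r * s *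
        c * R * z),
     symmMatrix (-D * At) (-kt) 0 (a * s ^ 2 * D * At + 2 * a * s * c * D * A)
      0 (a ^ 2 * s ^ 2 * z - a ^ 2 * s * c * zt - a ^ 2 * c ^ 2 * z) (-a * r * s ^ 2 * zt - 2 * a
        * r * s * c * z + a * s ^ 2 * kt + 2 * a * s * c * k)
      (-r * D * zt) 0
      (-a ^ 2 * s ^ 4 * D * At - 4 * a ^ 2 * s ^ 3 * c * D * A - r * s ^ 2 * D * zt - 2 * r * s *
        c * D * z),
     symmMatrix (a ^ 2 * s ^ 2 * Y - a ^ 2 * s * c * Yt - a ^ 2 * c ^ 2 * Y) 0 0 (-a * s ^ 2 * R * Y + a *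
        s * c * R * Yt + a * c ^ 2 * R * Y)
      0 (r * zt) (a * s ^ 2 * z - a * s * c * zt - a * c ^ 2 * z)
      (a ^ 2 * s ^ 2 * z - a ^ 2 * s * c * zt - a ^ 2 * c ^ 2 * z) 0
      (a ^ 2 * s ^ 4 * R * Y + a ^ 2 * s ^ 4 * U - a ^ 2 * s ^ 3 * c * R * Yt - a ^ 2 * s ^ 3 * c
        * Ut - 3 * a ^ 2 * s ^ 2 * c ^ 2 * R * Y - 3 * a ^ 2 * s ^ 2 * c ^ 2 * U + s ^ 2 * R * z
        - s * c * R * zt - c ^ 2 * R * z),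
     symmMatrix (a * At) 0 (a * s * t * U + a * c ^ 2 * t ^ 2 * U - a * c * t * Ut) (-a ^ 2 * s ^ 2 * At -
        2 * a ^ 2 * s * c * A)
      0 (-a * s * t * z - a * c ^ 2 * t ^ 2 * z + a * c * t * zt) (r * zt)
      (a * r * zt) (-a ^ 2 * s ^ 2 * U + a ^ 2 * s * c * Ut + a ^ 2 * c ^ 2 * U - s * t - c ^ 2 *
        t ^ 2)
      (a ^ 3 * s ^ 4 * At + 4 * a ^ 3 * s ^ 3 * c * A + a * r * s ^ 2 * zt + 2 * a * r * s * c *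
        z)]


theorem symmMatrix_comm (a₀₀ a₀₁ a₀₂ a₀₃ a₁₁ a₁₂ a₁₃ a₂₂ a₂₃ a₃₃ : ℝ) (i j : Fin 4) :
    symmMatrix a₀₀ a₀₁ a₀₂ a₀₃ a₁₁ a₁₂ a₁₃ a₂₂ a₂₃ a₃₃ i j
      = symmMatrix a₀₀ a₀₁ a₀₂ a₀₃ a₁₁ a₁₂ a₁₃ a₂₂ a₂₃ a₃₃ j i := by
  fin_cases i <;> fin_cases j <;> rfl

theorem gammaTable_comm (a r s c t z w v : ℝ) (A i j : Fin 4) :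
    gammaTable a r s c t z w v A i j = gammaTable a r s c t z w v A j i := by
  fin_cases A <;> exact symmMatrix_comm ..

theorem gammaTableR_comm (a r s c t z w v x : ℝ) (A i j : Fin 4) :
    gammaTableR a r s c t z w v x A i j = gammaTableR a r s c t z w v x A j i := by
  fin_cases A <;> exact symmMatrix_comm ..

theorem gammaTableTheta_comm (a r s c t z w v : ℝ) (A i j : Fin 4) :
    gammaTableTheta a r s c t z w v A i j = gammaTableTheta a r s c t z w v A j i := by
  fin_cases A <;> exact symmMatrix_comm ..

theorem metricTable_mul_inverseTable {a r s c t z w : ℝ} (hz : z * (r ^ 2 + a ^ 2 * c ^ 2) = 1)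
    (ht : t * s = 1) (hc : c ^ 2 = 1 - s ^ 2) :
    metricTable a r s c z w * inverseTable a r s t z w = 1 := by
  rw [hc] at hz
  have ht2 : t ^ 2 * s ^ 2 = 1 := by rw [← mul_pow, ht, one_pow]
  ext i j
  fin_cases i <;> fin_cases j <;>
    simp [metricTable, inverseTable, Matrix.mul_apply, Fin.sum_univ_four, hc]
  · linear_combination hz
  · linear_combination (-w * z) * hz
  · linear_combination (-a * w * z ^ 2) * ht2
  · ring
  · linear_combination hz
  · linear_combination a * z * ht2
  · linear_combination hz
  · ring
  · linear_combination a * w * s ^ 2 * z * hz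
  · linear_combination hz + ((r ^ 2 + a ^ 2) * z + w * z ^ 2 * a ^ 2 * s ^ 2) * ht2

/-- In the `φφ` entry `(r² + a²)² - (r² + a²)a² sin²θ = (r² + a²)R²` cancels the denominator when
`R² ≠ 0`. The table is then a polynomial in `1/R²`, which is easier to differentiate. -/
theorem ksMetric_eq_metricTable {a : ℝ} {w : ℝ → ℝ} {x : Event} (hx : x ∈ coordDomain) :
    ksMetric a w x = metricTable a (x 1) (Real.sin (x 2)) (Real.cos (x 2)) (Rsq a x)⁻¹
      (w (x 1)) := by
  have hS := (Rsq_pos (a := a) hx).ne'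
  have hc := Real.cos_sq' (x 2)
  ext i j
  fin_cases i <;> fin_cases j <;> simp [ksMetric, metricTable, div_eq_mul_inv]
  · simp [Rsq]
  · field_simp
    simp only [Rsq, hc]
    ring

theorem ksMetric_inv {a : ℝ} {w : ℝ → ℝ} {x : Event} (hx : x ∈ coordDomain) :
    (ksMetric a w x)⁻¹ = inverseTable a (x 1) (Real.sin (x 2)) (Real.sin (x 2))⁻¹ (Rsq a x)⁻¹
      (w (x 1)) := by
  refine Matrix.inv_eq_right_inv ?_
  rw [ksMetric_eq_metricTable hx]
  exact metricTable_mul_inverseTable (inv_mul_cancel₀ (Rsq_pos hx).ne')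
    (inv_mul_cancel₀ (sin_pos_of_mem hx).ne') (Real.cos_sq' _)

/-! ### Derivatives of the component tables -/

section Calculus

variable {a r θ : ℝ}

theorem hasDerivAt_inv_Rsq_r (h : r ^ 2 + a ^ 2 * Real.cos θ ^ 2 ≠ 0) :
    HasDerivAt (fun ρ => (ρ ^ 2 + a ^ 2 * Real.cos θ ^ 2)⁻¹)
      (-2 * r * (r ^ 2 + a ^ 2 * Real.cos θ ^ 2)⁻¹ ^ 2) r := by
  refine ((((hasDerivAt_id' r).fun_pow 2).add_const _).fun_inv h).congr_deriv ?_
  field_simp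
  simp only [Nat.cast_ofNat, Nat.reduceSub, pow_one]
  ring

theorem hasDerivAt_inv_Rsq_theta (h : r ^ 2 + a ^ 2 * Real.cos θ ^ 2 ≠ 0) :
    HasDerivAt (fun ϑ => (r ^ 2 + a ^ 2 * Real.cos ϑ ^ 2)⁻¹)
      (2 * a ^ 2 * Real.sin θ * Real.cos θ * (r ^ 2 + a ^ 2 * Real.cos θ ^ 2)⁻¹ ^ 2) θ := by
  refine (((((Real.hasDerivAt_cos θ).fun_pow 2).const_mul (a ^ 2)).const_add
    (r ^ 2)).fun_inv h).congr_deriv ?_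
  field_simp
  simp only [Nat.cast_ofNat, Nat.reduceSub, pow_one]
  ring

theorem hasDerivAt_inv_sin (h : Real.sin θ ≠ 0) :
    HasDerivAt (fun ϑ => (Real.sin ϑ)⁻¹) (- Real.cos θ * (Real.sin θ)⁻¹ ^ 2) θ := by
  refine ((Real.hasDerivAt_sin θ).fun_inv h).congr_deriv ?_
  field_simp

/-- The function `z` is known only through its differential equation `z' = -2rz²`, so
differentiation never meets a quotient. -/
theorem hasDerivAt_metricTable_r {s c w v : ℝ} {z W : ℝ → ℝ} (hz : HasDerivAt z (-2 * r * z r ^ 2) r)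
    (hW : HasDerivAt W v r) (hw : W r = w) (i j : Fin 4) :
    HasDerivAt (fun ρ => metricTable a ρ s c (z ρ) (W ρ) i j)
      (metricTableR a r s (z r) w v i j) r := by
  have hid := hasDerivAt_id' r
  subst hw
  fin_cases i <;> fin_cases j <;>
    simp only [metricTable, metricTableR, Fin.zero_eta, Fin.mk_one, Fin.reduceFinMk, Matrix.of_apply,
      Matrix.cons_val', Matrix.cons_val_zero, Matrix.cons_val_one, Matrix.cons_val,
      Matrix.cons_val_fin_one] <;>
    refine HasDerivAt.congr_deriv (by apply_rules [HasDerivAt.fun_pow, HasDerivAt.fun_add,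
      HasDerivAt.fun_sub, HasDerivAt.fun_neg, HasDerivAt.fun_mul, hasDerivAt_const]) ?_ <;>
    (try simp only [Nat.cast_ofNat, Nat.reduceSub, pow_one]) <;> ring

theorem hasDerivAt_metricTable_theta {w : ℝ} {z S C : ℝ → ℝ}
    (hz : HasDerivAt z (2 * a ^ 2 * S θ * C θ * z θ ^ 2) θ)
    (hS : HasDerivAt S (C θ) θ) (hC : HasDerivAt C (-S θ) θ) (i j : Fin 4) :
    HasDerivAt (fun ϑ => metricTable a r (S ϑ) (C ϑ) (z ϑ) w i j)
      (metricTableTheta a r (S θ) (C θ) (z θ) w i j) θ := by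
  fin_cases i <;> fin_cases j <;>
    simp only [metricTable, metricTableTheta, Fin.zero_eta, Fin.mk_one, Fin.reduceFinMk,
      Matrix.of_apply, Matrix.cons_val', Matrix.cons_val_zero, Matrix.cons_val_one, Matrix.cons_val,
      Matrix.cons_val_fin_one] <;>
    refine HasDerivAt.congr_deriv (by apply_rules [HasDerivAt.fun_pow, HasDerivAt.fun_add,
      HasDerivAt.fun_sub, HasDerivAt.fun_neg, HasDerivAt.fun_mul, hasDerivAt_const]) ?_ <;>
    (try simp only [Nat.cast_ofNat, Nat.reduceSub, pow_one]) <;> ring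

set_option maxHeartbeats 1000000 in
-- Symmetry in the lower indices makes `i ≤ j` sufficient: 40 entries instead of 64.
theorem hasDerivAt_gammaTable_r_of_le {s c t x : ℝ} {z W W' : ℝ → ℝ}
    (hz : HasDerivAt z (-2 * r * z r ^ 2) r)
    (hW : HasDerivAt W (W' r) r) (hW' : HasDerivAt W' x r) {i j : Fin 4}
    (hij : i ≤ j) (A : Fin 4) :
    HasDerivAt (fun ρ => gammaTable a ρ s c t (z ρ) (W ρ) (W' ρ) A i j)
      (gammaTableR a r s c t (z r) (W r) (W' r) x A i j) r := by
  have hid := hasDerivAt_id' r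
  fin_cases i <;> fin_cases j <;> first
  | exact absurd hij (by decide)
  | clear hij
    fin_cases A <;>
    simp only [gammaTable, gammaTableR, symmMatrix, Fin.zero_eta, Fin.mk_one, Fin.reduceFinMk, Matrix.of_apply,
      Matrix.cons_val', Matrix.cons_val_zero, Matrix.cons_val_one, Matrix.cons_val,
      Matrix.cons_val_fin_one, div_eq_mul_inv] <;>
    refine HasDerivAt.congr_deriv (by apply_rules [HasDerivAt.fun_pow, HasDerivAt.fun_add,
      HasDerivAt.fun_sub, HasDerivAt.fun_neg, HasDerivAt.fun_mul, hasDerivAt_const]) ?_ <;>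
    (try simp only [Nat.cast_ofNat, Nat.reduceSub, pow_one]) <;> ring

set_option maxHeartbeats 1000000 in
theorem hasDerivAt_gammaTable_theta_of_le {w v : ℝ} {z S C T : ℝ → ℝ}
    (hz : HasDerivAt z (2 * a ^ 2 * S θ * C θ * z θ ^ 2) θ)
    (hS : HasDerivAt S (C θ) θ) (hC : HasDerivAt C (-S θ) θ)
    (hT : HasDerivAt T (-C θ * T θ ^ 2) θ) {i j : Fin 4}
    (hij : i ≤ j) (A : Fin 4) :
    HasDerivAt (fun ϑ => gammaTable a r (S ϑ) (C ϑ) (T ϑ) (z ϑ) w v A i j)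
      (gammaTableTheta a r (S θ) (C θ) (T θ) (z θ) w v A i j) θ := by
  fin_cases i <;> fin_cases j <;> first
  | exact absurd hij (by decide)
  | clear hij
    fin_cases A <;>
    simp only [gammaTable, gammaTableTheta, symmMatrix, Fin.zero_eta, Fin.mk_one, Fin.reduceFinMk,
      Matrix.of_apply, Matrix.cons_val', Matrix.cons_val_zero, Matrix.cons_val_one, Matrix.cons_val,
      Matrix.cons_val_fin_one, div_eq_mul_inv] <;>
    refine HasDerivAt.congr_deriv (by apply_rules [HasDerivAt.fun_pow, HasDerivAt.fun_add,
      HasDerivAt.fun_sub, HasDerivAt.fun_neg, HasDerivAt.fun_mul, hasDerivAt_const]) ?_ <;>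
    (try simp only [Nat.cast_ofNat, Nat.reduceSub, pow_one]) <;> ring

theorem hasDerivAt_gammaTable_r {s c t x : ℝ} {z W W' : ℝ → ℝ}
    (hz : HasDerivAt z (-2 * r * z r ^ 2) r)
    (hW : HasDerivAt W (W' r) r) (hW' : HasDerivAt W' x r) (A i j : Fin 4) :
    HasDerivAt (fun ρ => gammaTable a ρ s c t (z ρ) (W ρ) (W' ρ) A i j)
      (gammaTableR a r s c t (z r) (W r) (W' r) x A i j) r := by
  rcases le_total i j with h | h
  · exact hasDerivAt_gammaTable_r_of_le hz hW hW' h A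
  · simp only [gammaTable_comm _ _ _ _ _ _ _ _ A i j, gammaTableR_comm _ _ _ _ _ _ _ _ _ A i j]
    exact hasDerivAt_gammaTable_r_of_le hz hW hW' h A

theorem hasDerivAt_gammaTable_theta {w v : ℝ} {z S C T : ℝ → ℝ}
    (hz : HasDerivAt z (2 * a ^ 2 * S θ * C θ * z θ ^ 2) θ)
    (hS : HasDerivAt S (C θ) θ) (hC : HasDerivAt C (-S θ) θ)
    (hT : HasDerivAt T (-C θ * T θ ^ 2) θ) (A i j : Fin 4) :
    HasDerivAt (fun ϑ => gammaTable a r (S ϑ) (C ϑ) (T ϑ) (z ϑ) w v A i j)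
      (gammaTableTheta a r (S θ) (C θ) (T θ) (z θ) w v A i j) θ := by
  rcases le_total i j with h | h
  · exact hasDerivAt_gammaTable_theta_of_le hz hS hC hT h A
  · simp only [gammaTable_comm _ _ _ _ _ _ _ _ A i j, gammaTableTheta_comm _ _ _ _ _ _ _ _ A i j]
    exact hasDerivAt_gammaTable_theta_of_le hz hS hC hT h A

end Calculus

/-! ### Connection and curvature as identities of rational functions -/

theorem christoffel_algebra {a r s c t z w v : ℝ} (hz : z * (r ^ 2 + a ^ 2 * c ^ 2) = 1)
    (ht : t * s = 1) (hc : c ^ 2 = 1 - s ^ 2) (A B C : Fin 4) :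
    1 / 2 * ∑ d, inverseTable a r s t z w A d *
      ((![0, metricTableR a r s z w v, metricTableTheta a r s c z w, 0] :
          Fin 4 → Matrix (Fin 4) (Fin 4) ℝ) B d C
        + (![0, metricTableR a r s z w v, metricTableTheta a r s c z w, 0] :
          Fin 4 → Matrix (Fin 4) (Fin 4) ℝ) C d B
        - (![0, metricTableR a r s z w v, metricTableTheta a r s c z w, 0] :
          Fin 4 → Matrix (Fin 4) (Fin 4) ℝ) d B C)
      = gammaTable a r s c t z w v A B C := by
  have hs : s ≠ 0 := right_ne_zero_of_mul_eq_one ht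
  rw [hc] at hz
  have hS : r ^ 2 + a ^ 2 * (1 - s ^ 2) ≠ 0 := right_ne_zero_of_mul_eq_one hz
  obtain rfl : z = (r ^ 2 + a ^ 2 * (1 - s ^ 2))⁻¹ := eq_inv_of_mul_eq_one_left hz
  obtain rfl : t = s⁻¹ := eq_inv_of_mul_eq_one_left ht
  -- Outside `z`, where it has been eliminated, `c` occurs at most linearly on both sides; the
  -- identity thus holds for independent `r`, `s`, `c`.
  clear ht hz hc
  fin_cases A <;> fin_cases B <;> fin_cases C <;>
    simp only [inverseTable, metricTableR, metricTableTheta, gammaTable, symmMatrix,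
      Fin.sum_univ_four, Fin.zero_eta, Fin.mk_one, Fin.reduceFinMk, Matrix.of_apply,
      Matrix.cons_val', Matrix.cons_val_zero, Matrix.cons_val_one, Matrix.cons_val,
      Matrix.cons_val_fin_one, Matrix.zero_apply] <;> field_simp <;> ring

/-- The derivatives `∂ᵢ Γᵃ_{bc}` of `gammaTable`. -/
def gammaDeriv (a r s c t z w v x : ℝ) (i : Fin 4) : Fin 4 → Matrix (Fin 4) (Fin 4) ℝ :=
  (![0, gammaTableR a r s c t z w v x, gammaTableTheta a r s c t z w v, 0] :
    Fin 4 → Fin 4 → Matrix (Fin 4) (Fin 4) ℝ) i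

/-- The Riemann tensor `Rᵃ_{bcd}` of the Kerr-Schild metric. -/
def riemannTable (a r s c t z w v x : ℝ) (A B C D : Fin 4) : ℝ :=
  gammaDeriv a r s c t z w v x C A D B - gammaDeriv a r s c t z w v x D A C B
    + ∑ e, (gammaTable a r s c t z w v A C e * gammaTable a r s c t z w v e D B
      - gammaTable a r s c t z w v A D e * gammaTable a r s c t z w v e C B)

/-- The Ricci tensor `(x / (2 R²) + 2 β) (ℓ ⊗ n + n ⊗ ℓ) - β g` of the Kerr-Schild metric, where
`β = (w - r v) / R⁴`. -/
def ricciTable (a r s c z w v x : ℝ) (B C : Fin 4) : ℝ :=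
  let h := (r ^ 2 + a ^ 2 - w) * z / 2
  let l : Fin 4 → ℝ := ![1, 0, 0, - a * s ^ 2]
  let n : Fin 4 → ℝ := ![h, 1, 0, - h * a * s ^ 2]
  let β := (w - r * v) * z ^ 2
  (x * z / 2 + 2 * β) * (l B * n C + l C * n B) - β * metricTable a r s c z w B C

set_option maxHeartbeats 2000000 in
theorem ricci_algebra {a r s c t z w v x : ℝ} (hz : z * (r ^ 2 + a ^ 2 * c ^ 2) = 1)
    (ht : t * s = 1) (hc : c ^ 2 = 1 - s ^ 2) (B C : Fin 4) :
    ∑ A, riemannTable a r s c t z w v x A B C A = ricciTable a r s c z w v x B C := by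
  have hs : s ≠ 0 := right_ne_zero_of_mul_eq_one ht
  rw [hc] at hz
  have hS : r ^ 2 + a ^ 2 * (1 - s ^ 2) ≠ 0 := right_ne_zero_of_mul_eq_one hz
  obtain rfl : z = (r ^ 2 + a ^ 2 * (1 - s ^ 2))⁻¹ := eq_inv_of_mul_eq_one_left hz
  obtain rfl : t = s⁻¹ := eq_inv_of_mul_eq_one_left ht
  clear ht hz
  -- Products of two factors `c` now occur, so after normalization `c²` is replaced by `1 - s²`.
  fin_cases B <;> fin_cases C <;>
    simp only [riemannTable, gammaDeriv, ricciTable, metricTable,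
      gammaTableR, gammaTableTheta, gammaTable, symmMatrix,
      Fin.sum_univ_four, Fin.zero_eta, Fin.mk_one, Fin.reduceFinMk, Matrix.of_apply,
      Matrix.cons_val', Matrix.cons_val_zero, Matrix.cons_val_one, Matrix.cons_val,
      Matrix.cons_val_fin_one, Matrix.zero_apply, Pi.zero_apply, mul_zero, zero_mul, add_zero,
      zero_add, sub_zero, zero_sub, sub_self] <;> field_simp <;> ring_nf <;>
      (try simp only [hc]) <;> ring

/-- With `ℓ·n = 1` the trace is `2(xz/2 + 2β) - 4β`, and β drops out. -/
theorem scalar_algebra {a r s c t z w v x : ℝ} (hz : z * (r ^ 2 + a ^ 2 * c ^ 2) = 1)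
    (ht : t * s = 1) (hc : c ^ 2 = 1 - s ^ 2) :
    ∑ A, ∑ B, inverseTable a r s t z w A B * ricciTable a r s c z w v x A B = x * z := by
  have hs : s ≠ 0 := right_ne_zero_of_mul_eq_one ht
  rw [hc] at hz
  have hS : r ^ 2 + a ^ 2 * (1 - s ^ 2) ≠ 0 := right_ne_zero_of_mul_eq_one hz
  obtain rfl : z = (r ^ 2 + a ^ 2 * (1 - s ^ 2))⁻¹ := eq_inv_of_mul_eq_one_left hz
  obtain rfl : t = s⁻¹ := eq_inv_of_mul_eq_one_left ht
  simp only [ricciTable, inverseTable, metricTable, hc,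
      Fin.sum_univ_four, Matrix.of_apply,
      Matrix.cons_val', Matrix.cons_val_zero, Matrix.cons_val_one, Matrix.cons_val,
      Matrix.cons_val_fin_one, mul_zero, zero_mul, add_zero,
      zero_add, zero_sub, sub_self]
  field_simp
  ring

/-- The mixed components `R^A{}_D` of the Ricci tensor are `diag`-like: `α` on the `ℓ`-`n` plane
and `- β` on its complement. -/
theorem ricciSquared_algebra {a r s c t z w v x : ℝ} (hz : z * (r ^ 2 + a ^ 2 * c ^ 2) = 1)
    (ht : t * s = 1) (hc : c ^ 2 = 1 - s ^ 2) :
    ∑ A, ∑ B, ∑ C, ∑ D, inverseTable a r s t z w A C * inverseTable a r s t z w B D *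
      ricciTable a r s c z w v x A B * ricciTable a r s c z w v x C D
      = 2 * (x * z / 2 + (w - r * v) * z ^ 2) ^ 2 + 2 * ((w - r * v) * z ^ 2) ^ 2 := by
  have hs : s ≠ 0 := right_ne_zero_of_mul_eq_one ht
  rw [hc] at hz
  have hS : r ^ 2 + a ^ 2 * (1 - s ^ 2) ≠ 0 := right_ne_zero_of_mul_eq_one hz
  obtain rfl : z = (r ^ 2 + a ^ 2 * (1 - s ^ 2))⁻¹ := eq_inv_of_mul_eq_one_left hz
  obtain rfl : t = s⁻¹ := eq_inv_of_mul_eq_one_left ht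
  simp only [ricciTable, inverseTable, metricTable, hc,
      Fin.sum_univ_four, Matrix.of_apply,
      Matrix.cons_val', Matrix.cons_val_zero, Matrix.cons_val_one, Matrix.cons_val,
      Matrix.cons_val_fin_one, mul_zero, zero_mul, add_zero,
      zero_add, zero_sub, sub_self]
  field_simp
  ring

/-- The contraction `R_{abcd} ℓᵃ` of the Riemann tensor. -/
def riemannRadialTable (a r s c z w v x : ℝ) (B C D : Fin 4) : ℝ :=
  let h := (r ^ 2 + a ^ 2 - w) * z / 2
  let l : Fin 4 → ℝ := ![1, 0, 0, - a * s ^ 2]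
  let n : Fin 4 → ℝ := ![h, 1, 0, - h * a * s ^ 2]
  let S : Fin 4 → Fin 4 → ℝ := fun i j => l i * n j + l j * n i - metricTable a r s c z w i j
  let ω : Matrix (Fin 4) (Fin 4) ℝ :=
    !![0, 0, - a * s, 0; 0, 0, 0, 0; a * s, 0, 0, - (r ^ 2 + a ^ 2) * s;
      0, 0, (r ^ 2 + a ^ 2) * s, 0]
  let E₁ := - v * z ^ 2 * r / 2 + w * z ^ 3 * (r ^ 2 - a ^ 2 * c ^ 2)
  let E₂ := - v * z ^ 2 * a * c / 2 + 2 * w * z ^ 3 * r * a * c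
  (- x * z / 2 + 2 * r * v * z ^ 2 - (3 * r ^ 2 - a ^ 2 * c ^ 2) * w * z ^ 3) * l B *
      (l C * n D - n C * l D)
    - 2 * E₂ * l B * ω C D + E₁ * (S B C * l D - S B D * l C) + E₂ * (ω B C * l D - ω B D * l C)

theorem riemannTable_swap (a r s c t z w v x : ℝ) (A B C D : Fin 4) :
    riemannTable a r s c t z w v x A B D C = - riemannTable a r s c t z w v x A B C D := by
  simp only [riemannTable, Fin.sum_univ_four]
  ring

theorem riemannRadialTable_swap (a r s c z w v x : ℝ) (B C D : Fin 4) :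
    riemannRadialTable a r s c z w v x B D C = - riemannRadialTable a r s c z w v x B C D := by
  have hω : (!![0, 0, - a * s, 0; 0, 0, 0, 0; a * s, 0, 0, - (r ^ 2 + a ^ 2) * s;
      0, 0, (r ^ 2 + a ^ 2) * s, 0] : Matrix (Fin 4) (Fin 4) ℝ) D C
      = - (!![0, 0, - a * s, 0; 0, 0, 0, 0; a * s, 0, 0, - (r ^ 2 + a ^ 2) * s;
      0, 0, (r ^ 2 + a ^ 2) * s, 0] : Matrix (Fin 4) (Fin 4) ℝ) C D := by
    fin_cases C <;> fin_cases D <;> simp <;> ring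
  simp only [riemannRadialTable, hω]
  ring

set_option maxHeartbeats 2000000 in
-- Since `ℓᵃ = ∂_r`, the contraction defining ψ₂ needs only first index 1, not the whole Riemann
-- tensor. Antisymmetry in the last pair leaves the six pairs `C < D`.
theorem riemannRadial_algebra_of_lt {a r s c t z w v x : ℝ} (hz : z * (r ^ 2 + a ^ 2 * c ^ 2) = 1)
    (ht : t * s = 1) (hc : c ^ 2 = 1 - s ^ 2) {C D : Fin 4} (h : C < D)
    (B : Fin 4) :
    ∑ e, metricTable a r s c z w 1 e * riemannTable a r s c t z w v x e B C D
      = riemannRadialTable a r s c z w v x B C D := by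
  have hs : s ≠ 0 := right_ne_zero_of_mul_eq_one ht
  rw [hc] at hz
  have hS : r ^ 2 + a ^ 2 * (1 - s ^ 2) ≠ 0 := right_ne_zero_of_mul_eq_one hz
  obtain rfl : z = (r ^ 2 + a ^ 2 * (1 - s ^ 2))⁻¹ := eq_inv_of_mul_eq_one_left hz
  obtain rfl : t = s⁻¹ := eq_inv_of_mul_eq_one_left ht
  clear ht hz
  -- The product of `E₁` and `S 2 2` in the radial table is quartic in `c`.
  have hc4 : c ^ 4 = (1 - s ^ 2) ^ 2 := by rw [← hc]; ring
  fin_cases C <;> fin_cases D <;> first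
  | exact absurd h (by decide)
  | clear h
    fin_cases B <;>
    simp only [riemannRadialTable, riemannTable, gammaDeriv, metricTable,
      gammaTableR, gammaTableTheta, gammaTable, symmMatrix,
      Fin.sum_univ_four, Fin.zero_eta, Fin.mk_one, Fin.reduceFinMk, Matrix.of_apply,
      Matrix.cons_val', Matrix.cons_val_zero, Matrix.cons_val_one, Matrix.cons_val,
      Matrix.cons_val_fin_one, Matrix.zero_apply, Pi.zero_apply, mul_zero, zero_mul, add_zero,
      zero_add, sub_zero, zero_sub, sub_self] <;> field_simp <;> ring_nf <;>
      (try simp only [hc, hc4]) <;> (try ring_nf)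

theorem riemannRadial_algebra {a r s c t z w v x : ℝ} (hz : z * (r ^ 2 + a ^ 2 * c ^ 2) = 1)
    (ht : t * s = 1) (hc : c ^ 2 = 1 - s ^ 2) (B C D : Fin 4) :
    ∑ e, metricTable a r s c z w 1 e * riemannTable a r s c t z w v x e B C D
      = riemannRadialTable a r s c z w v x B C D := by
  rcases lt_trichotomy C D with h | rfl | h
  · exact riemannRadial_algebra_of_lt hz ht hc h B
  · have h1 : ∀ e, riemannTable a r s c t z w v x e B C C = 0 := fun e =>
      self_eq_neg.1 (riemannTable_swap a r s c t z w v x e B C C)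
    rw [self_eq_neg.1 (riemannRadialTable_swap a r s c z w v x B C C)]
    simp [h1]
  · have := riemannRadial_algebra_of_lt (x := x) (w := w) (v := v) hz ht hc h B
    rw [riemannRadialTable_swap, ← this]
    simp only [riemannTable_swap a r s c t z w v x _ B D C, mul_neg, Finset.sum_neg_distrib]

/-! ### Curvature of the Kerr-Schild metric -/

section Curvature

variable {a : ℝ} {w w' w'' : ℝ → ℝ} {x : Event}

theorem inv_Rsq_mul (hx : x ∈ coordDomain) :
    (Rsq a x)⁻¹ * (x 1 ^ 2 + a ^ 2 * Real.cos (x 2) ^ 2) = 1 :=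
  inv_mul_cancel₀ (Rsq_pos (a := a) hx).ne'

theorem inv_sin_mul (hx : x ∈ coordDomain) : (Real.sin (x 2))⁻¹ * Real.sin (x 2) = 1 :=
  inv_mul_cancel₀ (sin_pos_of_mem hx).ne'

theorem pderivAt_ksMetric (hx : x ∈ coordDomain) (hw : HasDerivAt w (w' (x 1)) (x 1))
    (i j k : Fin 4) :
    pderivAt i (fun y => ksMetric a w y j k) x =
      (![0, metricTableR a (x 1) (Real.sin (x 2)) (Rsq a x)⁻¹ (w (x 1)) (w' (x 1)),
        metricTableTheta a (x 1) (Real.sin (x 2)) (Real.cos (x 2)) (Rsq a x)⁻¹ (w (x 1)), 0] :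
          Fin 4 → Matrix (Fin 4) (Fin 4) ℝ) i j k := by
  have hS := (Rsq_pos (a := a) hx).ne'
  rw [pderivAt_of_hasDerivAt (F := fun ρ ϑ => metricTable a ρ (Real.sin ϑ) (Real.cos ϑ)
    (ρ ^ 2 + a ^ 2 * Real.cos ϑ ^ 2)⁻¹ (w ρ) j k) ?_
    (hasDerivAt_metricTable_r (hasDerivAt_inv_Rsq_r hS) hw rfl j k)
    (hasDerivAt_metricTable_theta (hasDerivAt_inv_Rsq_theta hS) (Real.hasDerivAt_sin _)
      (Real.hasDerivAt_cos _) j k)]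
  · fin_cases i <;> rfl
  · filter_upwards [coordDomain_mem_nhds hx] with y hy
    rw [ksMetric_eq_metricTable hy, Rsq]

theorem christoffel_ksMetric (hx : x ∈ coordDomain) (hw : HasDerivAt w (w' (x 1)) (x 1))
    (A B C : Fin 4) :
    christoffel (ksMetric a w) A B C x = gammaTable a (x 1) (Real.sin (x 2)) (Real.cos (x 2))
      (Real.sin (x 2))⁻¹ (Rsq a x)⁻¹ (w (x 1)) (w' (x 1)) A B C := by
  simp only [christoffel, pderivAt_ksMetric hx hw, ksMetric_inv hx]
  exact christoffel_algebra (inv_Rsq_mul hx) (inv_sin_mul hx) (Real.cos_sq' _) A B C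

/-- The formula for the Christoffel symbols is to be differentiated, hence must hold near `x`; this
is why `hw` is assumed for all radii, while `hw'` concerns only the radius of `x`. -/
theorem pderivAt_christoffel_ksMetric (hx : x ∈ coordDomain)
    (hw : ∀ r, 0 < r → HasDerivAt w (w' r) r) (hw' : HasDerivAt w' (w'' (x 1)) (x 1))
    (i A B C : Fin 4) :
    pderivAt i (christoffel (ksMetric a w) A B C) x =
      gammaDeriv a (x 1) (Real.sin (x 2)) (Real.cos (x 2)) (Real.sin (x 2))⁻¹ (Rsq a x)⁻¹
        (w (x 1)) (w' (x 1)) (w'' (x 1)) i A B C := by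
  have hS := (Rsq_pos (a := a) hx).ne'
  rw [pderivAt_of_hasDerivAt (F := fun ρ ϑ => gammaTable a ρ (Real.sin ϑ) (Real.cos ϑ)
    (Real.sin ϑ)⁻¹ (ρ ^ 2 + a ^ 2 * Real.cos ϑ ^ 2)⁻¹ (w ρ) (w' ρ) A B C) ?_
    (hasDerivAt_gammaTable_r (hasDerivAt_inv_Rsq_r hS) (hw _ hx.1) hw' A B C)
    (hasDerivAt_gammaTable_theta (hasDerivAt_inv_Rsq_theta hS) (Real.hasDerivAt_sin _)
      (Real.hasDerivAt_cos _) (hasDerivAt_inv_sin (sin_pos_of_mem hx).ne') A B C)]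
  · fin_cases i <;> rfl
  · filter_upwards [coordDomain_mem_nhds hx] with y hy
    rw [christoffel_ksMetric hy (hw _ hy.1), Rsq]

theorem riemannUp_ksMetric (hx : x ∈ coordDomain)
    (hw : ∀ r, 0 < r → HasDerivAt w (w' r) r) (hw' : HasDerivAt w' (w'' (x 1)) (x 1))
    (A B C D : Fin 4) :
    riemannUp (ksMetric a w) A B C D x =
      riemannTable a (x 1) (Real.sin (x 2)) (Real.cos (x 2)) (Real.sin (x 2))⁻¹ (Rsq a x)⁻¹
        (w (x 1)) (w' (x 1)) (w'' (x 1)) A B C D := by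
  simp only [riemannUp, pderivAt_christoffel_ksMetric hx hw hw',
    christoffel_ksMetric hx (hw _ hx.1), riemannTable]

theorem ricciTensor_ksMetric (hx : x ∈ coordDomain)
    (hw : ∀ r, 0 < r → HasDerivAt w (w' r) r) (hw' : HasDerivAt w' (w'' (x 1)) (x 1))
    (B C : Fin 4) :
    ricciTensor (ksMetric a w) B C x =
      ricciTable a (x 1) (Real.sin (x 2)) (Real.cos (x 2)) (Rsq a x)⁻¹
        (w (x 1)) (w' (x 1)) (w'' (x 1)) B C := by
  simp only [ricciTensor, riemannUp_ksMetric hx hw hw']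
  exact ricci_algebra (inv_Rsq_mul hx) (inv_sin_mul hx) (Real.cos_sq' _) B C

/-- Linear in the profile and blind to its affine part: the mass and a constant charge cannot affect
the scalar Λ. -/
theorem scalarCurv_ksMetric (hx : x ∈ coordDomain)
    (hw : ∀ r, 0 < r → HasDerivAt w (w' r) r) (hw' : HasDerivAt w' (w'' (x 1)) (x 1)) :
    scalarCurv (ksMetric a w) x = w'' (x 1) * (Rsq a x)⁻¹ := by
  simp only [scalarCurv, ricciTensor_ksMetric hx hw hw', ksMetric_inv hx]
  exact scalar_algebra (inv_Rsq_mul hx) (inv_sin_mul hx) (Real.cos_sq' _)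

theorem ricciSquared_ksMetric (hx : x ∈ coordDomain)
    (hw : ∀ r, 0 < r → HasDerivAt w (w' r) r) (hw' : HasDerivAt w' (w'' (x 1)) (x 1)) :
    ricciSquared (ksMetric a w) x =
      2 * (w'' (x 1) * (Rsq a x)⁻¹ / 2 + (w (x 1) - x 1 * w' (x 1)) * (Rsq a x)⁻¹ ^ 2) ^ 2
        + 2 * ((w (x 1) - x 1 * w' (x 1)) * (Rsq a x)⁻¹ ^ 2) ^ 2 := by
  simp only [ricciSquared, ricciTensor_ksMetric hx hw hw', ksMetric_inv hx]
  exact ricciSquared_algebra (inv_Rsq_mul hx) (inv_sin_mul hx) (Real.cos_sq' _)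

theorem riemannLow_ksMetric_radial (hx : x ∈ coordDomain)
    (hw : ∀ r, 0 < r → HasDerivAt w (w' r) r) (hw' : HasDerivAt w' (w'' (x 1)) (x 1))
    (B C D : Fin 4) :
    riemannLow (ksMetric a w) 1 B C D x =
      riemannRadialTable a (x 1) (Real.sin (x 2)) (Real.cos (x 2)) (Rsq a x)⁻¹
        (w (x 1)) (w' (x 1)) (w'' (x 1)) B C D := by
  simp only [riemannLow, riemannUp_ksMetric hx hw hw', ksMetric_eq_metricTable hx]
  exact riemannRadial_algebra (inv_Rsq_mul hx) (inv_sin_mul hx) (Real.cos_sq' _) B C D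

end Curvature

/-! ### The null tetrad -/

section Tetrad

variable {a Λ M : ℝ} {q w : ℝ → ℝ} {x : Event}

/-- The factor `- 1 / (√2 R)` of the covector `m`. -/
def tetradFactor (a : ℝ) (x : Event) : ℂ := - 1 / ((Real.sqrt 2 : ℂ) * Rcx a x)

theorem Rcx_mul_conj : Rcx a x * starRingEnd ℂ (Rcx a x) = ((Rsq a x : ℝ) : ℂ) := by
  rw [Complex.mul_conj]
  congr 1
  simp [Rcx, Rsq, Complex.normSq_apply, -Complex.ofReal_cos]
  ring

theorem Rcx_ne_zero (hx : x ∈ coordDomain) : Rcx a x ≠ 0 := by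
  intro h
  have := Rcx_mul_conj (a := a) (x := x)
  rw [h, zero_mul] at this
  exact (Rsq_pos (a := a) hx).ne' (by exact_mod_cast this.symm)

theorem conj_Rcx_ne_zero (hx : x ∈ coordDomain) : starRingEnd ℂ (Rcx a x) ≠ 0 :=
  (map_ne_zero _).2 (Rcx_ne_zero hx)

theorem tetradFactor_mul_conj :
    tetradFactor a x * starRingEnd ℂ (tetradFactor a x) = (((Rsq a x)⁻¹ / 2 : ℝ) : ℂ) := by
  have h2 : (Real.sqrt 2 : ℂ) * (Real.sqrt 2 : ℂ) = 2 := by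
    exact_mod_cast Real.mul_self_sqrt (by norm_num : (0 : ℝ) ≤ 2)
  simp only [tetradFactor, map_div₀, map_neg, map_one, map_mul, Complex.conj_ofReal]
  rw [div_mul_div_comm, mul_mul_mul_comm, h2, Rcx_mul_conj]
  push_cast
  rw [neg_mul_neg, one_mul, one_div, mul_inv, div_eq_mul_inv, mul_comm]

/-- The raised ℓ is `∂_r` whatever the profile, so contraction with it selects the component with
index 1. -/
theorem raiseIndex_tetradL (hx : x ∈ coordDomain) :
    raiseIndex (ksMetric a w) x (tetradL a x) = ![0, 1, 0, 0] := by
  have hz := inv_Rsq_mul (a := a) hx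
  have ht := inv_sin_mul hx
  have hc := Real.cos_sq' (x 2)
  ext i
  simp only [raiseIndex, ksMetric_inv hx, inverseTable, tetradL, Fin.sum_univ_four]
  -- Trigonometry is forgotten: only `zR² = 1`, `ts = 1` and `c² = 1 - s²` are kept, and then cast
  -- to ℂ.
  generalize (Rsq a x)⁻¹ = z at *
  generalize Real.sin (x 2) = s at *
  generalize Real.cos (x 2) = c at *
  generalize s⁻¹ = t at *
  have hz := congrArg ((↑) : ℝ → ℂ) hz
  have ht := congrArg ((↑) : ℝ → ℂ) ht
  have hc := congrArg ((↑) : ℝ → ℂ) hc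
  push_cast at hz ht hc
  fin_cases i <;> simp
  · ring
  · linear_combination hz - (z : ℂ) * a ^ 2 * hc
  · linear_combination (z : ℂ) * a * (t * s + 1) * ht

/-- The hypothesis `hD` matches the covector `n`, written with `Δ*`, to the metric, written with the
profile. -/
theorem raiseIndex_tetradN (hx : x ∈ coordDomain)
    (hD : DeltaStar a Λ M q x = x 1 ^ 2 + a ^ 2 - w (x 1)) :
    raiseIndex (ksMetric a w) x (tetradN a Λ M q x) =
      ![(((x 1 ^ 2 + a ^ 2) * (Rsq a x)⁻¹ : ℝ) : ℂ),
        ((- (x 1 ^ 2 + a ^ 2 - w (x 1)) * (Rsq a x)⁻¹ / 2 : ℝ) : ℂ), 0,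
        ((a * (Rsq a x)⁻¹ : ℝ) : ℂ)] := by
  have hz := inv_Rsq_mul (a := a) hx
  have ht := inv_sin_mul hx
  have hc := Real.cos_sq' (x 2)
  ext i
  simp only [raiseIndex, ksMetric_inv hx, inverseTable, tetradN, Fin.sum_univ_four, hD,
    div_eq_mul_inv, mul_inv]
  generalize (Rsq a x)⁻¹ = z at *
  generalize Real.sin (x 2) = s at *
  generalize Real.cos (x 2) = c at *
  generalize s⁻¹ = t at *
  have hz := congrArg ((↑) : ℝ → ℂ) hz
  have ht := congrArg ((↑) : ℝ → ℂ) ht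
  have hc := congrArg ((↑) : ℝ → ℂ) hc
  push_cast at hz ht hc
  fin_cases i <;> simp
  · ring
  · linear_combination (((x 1 : ℂ) ^ 2 + a ^ 2 - w (x 1)) * z / 2) *
      (hz - (z : ℂ) * a ^ 2 * hc)
  · linear_combination (((x 1 : ℂ) ^ 2 + a ^ 2 - w (x 1)) * z / 2) *
      ((z : ℂ) * a * (t * s + 1) * ht)

theorem raiseIndex_tetradM (hx : x ∈ coordDomain) :
    raiseIndex (ksMetric a w) x (tetradM a x) =
      ![- tetradFactor a x * Complex.I * ((a * Real.sin (x 2) : ℝ) : ℂ), 0, - tetradFactor a x,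
        - tetradFactor a x * Complex.I * (((Real.sin (x 2))⁻¹ : ℝ) : ℂ)] := by
  have hz := inv_Rsq_mul (a := a) hx
  have ht := inv_sin_mul hx
  have hc := Real.cos_sq' (x 2)
  have hS : Rsq a x = x 1 ^ 2 + a ^ 2 * Real.cos (x 2) ^ 2 := rfl
  ext i
  simp only [raiseIndex, ksMetric_inv hx, inverseTable, tetradM, Fin.sum_univ_four]
  rw [← tetradFactor]
  generalize (Rsq a x)⁻¹ = z at *
  rw [hS]
  generalize tetradFactor a x = k at *
  generalize Real.sin (x 2) = s at *
  generalize Real.cos (x 2) = c at *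
  generalize s⁻¹ = t at *
  have hz := congrArg ((↑) : ℝ → ℂ) hz
  have ht := congrArg ((↑) : ℝ → ℂ) ht
  have hc := congrArg ((↑) : ℝ → ℂ) hc
  push_cast at hz ht hc
  fin_cases i <;> simp
  · linear_combination (-k * Complex.I * a * s) * (hz - (z : ℂ) * a ^ 2 * hc)
  · ring
  · linear_combination k * hz
  · linear_combination (-k * Complex.I * t) * (hz - (z : ℂ) * a ^ 2 * hc)
      - k * Complex.I * z * (((x 1 : ℂ) ^ 2 + a ^ 2) * t + a ^ 2 * s) * ht

/-- The products `m_i m̄_j` in the tetrad, up to the factor `1 / (2 R²)`. -/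
theorem tetradM_mul_conj_add (i j : Fin 4) (hx : x ∈ coordDomain) :
    tetradM a x i * conjCovector (tetradM a x) j + tetradM a x j * conjCovector (tetradM a x) i
      = ((let h := (x 1 ^ 2 + a ^ 2 - w (x 1)) * (Rsq a x)⁻¹ / 2
          let l : Fin 4 → ℝ := ![1, 0, 0, - a * Real.sin (x 2) ^ 2]
          let n : Fin 4 → ℝ := ![h, 1, 0, - h * a * Real.sin (x 2) ^ 2]
          l i * n j + l j * n i - metricTable a (x 1) (Real.sin (x 2)) (Real.cos (x 2))
            (Rsq a x)⁻¹ (w (x 1)) i j : ℝ) : ℂ) := by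
  have hz := inv_Rsq_mul (a := a) hx
  have hc := Real.cos_sq' (x 2)
  have hS : Rsq a x = x 1 ^ 2 + a ^ 2 * Real.cos (x 2) ^ 2 := rfl
  have hk := tetradFactor_mul_conj (a := a) (x := x)
  simp only [tetradM, conjCovector, metricTable]
  rw [← tetradFactor]
  generalize (Rsq a x)⁻¹ = z at *
  rw [hS]
  generalize tetradFactor a x = k at *
  generalize Real.sin (x 2) = s at *
  generalize Real.cos (x 2) = c at *
  have hz := congrArg ((↑) : ℝ → ℂ) hz
  have hc := congrArg ((↑) : ℝ → ℂ) hc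
  push_cast at hz hc hk
  generalize hk' : starRingEnd ℂ k = k' at *
  fin_cases i <;> fin_cases j <;> simp [hk']
  · linear_combination (-2 * k * k' * a ^ 2 * s ^ 2) * Complex.I_sq + (2 * a ^ 2 * s ^ 2 : ℂ) * hk
      - hz + (z : ℂ) * a ^ 2 * hc
  · ring
  · linear_combination (2 * k * k' * a * s ^ 2 * ((x 1 : ℂ) ^ 2 + a ^ 2)) * Complex.I_sq
      - (2 * a * s ^ 2 * ((x 1 : ℂ) ^ 2 + a ^ 2)) * hk
  · ring
  · linear_combination (2 * ((x 1 : ℂ) ^ 2 + a ^ 2 * c ^ 2) ^ 2) * hk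
      + ((x 1 : ℂ) ^ 2 + a ^ 2 * c ^ 2) * hz
  · ring
  · linear_combination (2 * k * k' * a * s ^ 2 * ((x 1 : ℂ) ^ 2 + a ^ 2)) * Complex.I_sq
      - (2 * a * s ^ 2 * ((x 1 : ℂ) ^ 2 + a ^ 2)) * hk
  · ring
  · linear_combination (-2 * k * k' * s ^ 2 * ((x 1 : ℂ) ^ 2 + a ^ 2) ^ 2) * Complex.I_sq
      + (2 * s ^ 2 * ((x 1 : ℂ) ^ 2 + a ^ 2) ^ 2) * hk
      + ((x 1 : ℂ) ^ 2 + a ^ 2) * s ^ 2 * (hz - (z : ℂ) * a ^ 2 * hc)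

end Tetrad

/-! ### The Weyl scalar ψ₂ -/

section Weyl

variable {a Λ M : ℝ} {q w w' w'' : ℝ → ℝ} {x : Event}

theorem raiseIndex_conjCovector (g : TensorField2) (x : Event) (v : Fin 4 → ℂ) (i : Fin 4) :
    raiseIndex g x (conjCovector v) i = starRingEnd ℂ (raiseIndex g x v i) := by
  simp [raiseIndex, conjCovector, map_sum]

/-- The contraction `C_{abcd} ℓᵃ` of the Weyl tensor of the Kerr-Schild metric. -/
def weylRadialTable (a r s c z w v x : ℝ) (B C D : Fin 4) : ℝ :=
  riemannRadialTable a r s c z w v x B C D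
    + 1 / 2 * (metricTable a r s c z w 1 C * ricciTable a r s c z w v x B D
      - metricTable a r s c z w 1 D * ricciTable a r s c z w v x B C
      - metricTable a r s c z w B C * ricciTable a r s c z w v x 1 D
      + metricTable a r s c z w B D * ricciTable a r s c z w v x 1 C)
    - x * z / 6 * (metricTable a r s c z w 1 C * metricTable a r s c z w B D
      - metricTable a r s c z w 1 D * metricTable a r s c z w B C)

theorem weylTensor_ksMetric_radial (hx : x ∈ coordDomain)
    (hw : ∀ r, 0 < r → HasDerivAt w (w' r) r) (hw' : HasDerivAt w' (w'' (x 1)) (x 1))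
    (B C D : Fin 4) :
    weylTensor (ksMetric a w) 1 B C D x =
      weylRadialTable a (x 1) (Real.sin (x 2)) (Real.cos (x 2)) (Rsq a x)⁻¹
        (w (x 1)) (w' (x 1)) (w'' (x 1)) B C D := by
  simp only [weylTensor, riemannLow_ksMetric_radial hx hw hw', ricciTensor_ksMetric hx hw hw',
    scalarCurv_ksMetric hx hw hw', ksMetric_eq_metricTable hx, weylRadialTable]

/-- With `R = r + iac`, this and `weylRadial_algebra_im` are the real and imaginary parts of `x/6 -
vzR + 2w(zR)²`. -/
theorem weylRadial_algebra_re {a r s c t z w v x : ℝ} (hz : z * (r ^ 2 + a ^ 2 * c ^ 2) = 1)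
    (ht : t * s = 1) (hc : c ^ 2 = 1 - s ^ 2) :
    let W := weylRadialTable a r s c z w v x
    let n : Fin 4 → ℝ := ![(r ^ 2 + a ^ 2) * z, - (r ^ 2 + a ^ 2 - w) * z / 2, 0, a * z]
    ∑ d, n d * (W 2 2 d + (a * s) ^ 2 * W 0 0 d + t ^ 2 * W 3 3 d + a * s * t * (W 0 3 d + W 3 0 d))
      = x / 6 - v * z * r + 2 * w * z ^ 2 * (r ^ 2 - a ^ 2 * c ^ 2) := by
  have hs : s ≠ 0 := right_ne_zero_of_mul_eq_one ht
  rw [hc] at hz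
  have hS : r ^ 2 + a ^ 2 * (1 - s ^ 2) ≠ 0 := right_ne_zero_of_mul_eq_one hz
  obtain rfl : z = (r ^ 2 + a ^ 2 * (1 - s ^ 2))⁻¹ := eq_inv_of_mul_eq_one_left hz
  obtain rfl : t = s⁻¹ := eq_inv_of_mul_eq_one_left ht
  simp only [weylRadialTable, riemannRadialTable, ricciTable, metricTable, hc,
      Fin.sum_univ_four, Matrix.of_apply,
      Matrix.cons_val', Matrix.cons_val_zero, Matrix.cons_val_one, Matrix.cons_val,
      Matrix.cons_val_fin_one, mul_zero, zero_mul, add_zero,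
      zero_add, sub_zero, zero_sub, sub_self]
  field_simp
  ring

theorem weylRadial_algebra_im {a r s c t z w v x : ℝ} (hz : z * (r ^ 2 + a ^ 2 * c ^ 2) = 1)
    (ht : t * s = 1) (hc : c ^ 2 = 1 - s ^ 2) :
    let W := weylRadialTable a r s c z w v x
    let n : Fin 4 → ℝ := ![(r ^ 2 + a ^ 2) * z, - (r ^ 2 + a ^ 2 - w) * z / 2, 0, a * z]
    ∑ d, n d * (a * s * (W 0 2 d - W 2 0 d) + t * (W 3 2 d - W 2 3 d))
      = - v * z * a * c + 4 * w * z ^ 2 * r * a * c := by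
  have hs : s ≠ 0 := right_ne_zero_of_mul_eq_one ht
  rw [hc] at hz
  have hS : r ^ 2 + a ^ 2 * (1 - s ^ 2) ≠ 0 := right_ne_zero_of_mul_eq_one hz
  obtain rfl : z = (r ^ 2 + a ^ 2 * (1 - s ^ 2))⁻¹ := eq_inv_of_mul_eq_one_left hz
  obtain rfl : t = s⁻¹ := eq_inv_of_mul_eq_one_left ht
  simp only [weylRadialTable, riemannRadialTable, ricciTable, metricTable, hc,
      Fin.sum_univ_four, Matrix.of_apply,
      Matrix.cons_val', Matrix.cons_val_zero, Matrix.cons_val_one, Matrix.cons_val,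
      Matrix.cons_val_fin_one, mul_zero, zero_mul, add_zero,
      zero_add, sub_zero, zero_sub, sub_self]
  field_simp
  ring

/-- The components of the raised `m` are `-k` times 0, 1 or an imaginary number. So `k k̄` factors
out, and the part of `W` symmetric in the first two indices gives the real part, the antisymmetric
one the imaginary part. -/
theorem tetrad_contraction (W : Fin 4 → Fin 4 → Fin 4 → ℝ) (k : ℂ) (p q n₀ n₁ n₃ : ℝ) :
    let u : Fin 4 → ℂ := ![- k * Complex.I * p, 0, - k, - k * Complex.I * q]
    let n : Fin 4 → ℝ := ![n₀, n₁, 0, n₃]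
    ∑ b, ∑ c, ∑ d, ((W b c d : ℝ) : ℂ) * u b * starRingEnd ℂ (u c) *
        (![(n₀ : ℂ), (n₁ : ℂ), 0, (n₃ : ℂ)] : Fin 4 → ℂ) d
      = k * starRingEnd ℂ k *
        (((∑ d, n d * (W 2 2 d + p ^ 2 * W 0 0 d + q ^ 2 * W 3 3 d
            + p * q * (W 0 3 d + W 3 0 d)) : ℝ) : ℂ)
          + Complex.I * ((∑ d, n d * (p * (W 0 2 d - W 2 0 d)
            + q * (W 3 2 d - W 2 3 d)) : ℝ) : ℂ)) := by
  simp only [Fin.sum_univ_four, Matrix.cons_val_zero, Matrix.cons_val_one, Matrix.cons_val,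
    map_mul, map_neg, map_zero, Complex.conj_I, Complex.conj_ofReal]
  push_cast
  generalize starRingEnd ℂ k = k'
  linear_combination (-k * k') * (n₀ * (p ^ 2 * W 0 0 0 + q ^ 2 * W 3 3 0
    + p * q * (W 0 3 0 + W 3 0 0)) + n₁ * (p ^ 2 * W 0 0 1 + q ^ 2 * W 3 3 1
    + p * q * (W 0 3 1 + W 3 0 1)) + n₃ * (p ^ 2 * W 0 0 3 + q ^ 2 * W 3 3 3
    + p * q * (W 0 3 3 + W 3 0 3))) * Complex.I_sq

theorem npPsi2_ksMetric (hx : x ∈ coordDomain)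
    (hw : ∀ r, 0 < r → HasDerivAt w (w' r) r) (hw' : HasDerivAt w' (w'' (x 1)) (x 1))
    (hD : DeltaStar a Λ M q x = x 1 ^ 2 + a ^ 2 - w (x 1)) :
    npPsi2 (ksMetric a w) (tetradL a x) (tetradN a Λ M q x) (tetradM a x) x
      = - ((Rsq a x : ℂ)⁻¹ / 2 * ((w'' (x 1) : ℂ) / 6 - w' (x 1) * (Rsq a x : ℂ)⁻¹ * Rcx a x
        + 2 * w (x 1) * ((Rsq a x : ℂ)⁻¹ * Rcx a x) ^ 2)) := by
  have key := tetrad_contraction (weylRadialTable a (x 1) (Real.sin (x 2)) (Real.cos (x 2))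
    (Rsq a x)⁻¹ (w (x 1)) (w' (x 1)) (w'' (x 1))) (tetradFactor a x) (a * Real.sin (x 2))
    (Real.sin (x 2))⁻¹ ((x 1 ^ 2 + a ^ 2) * (Rsq a x)⁻¹)
    (- (x 1 ^ 2 + a ^ 2 - w (x 1)) * (Rsq a x)⁻¹ / 2) (a * (Rsq a x)⁻¹)
  have h := inv_Rsq_mul (a := a) hx
  have h' := inv_sin_mul hx
  have h'' := Real.cos_sq' (x 2)
  simp only [weylRadial_algebra_re h h' h'', weylRadial_algebra_im h h' h'',
    tetradFactor_mul_conj] at key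
  simp only [npPsi2, raiseIndex_conjCovector, raiseIndex_tetradL hx, raiseIndex_tetradM hx,
    raiseIndex_tetradN hx hD]
  rw [Fin.sum_univ_four]
  simp only [Matrix.cons_val_zero, Matrix.cons_val_one, Matrix.cons_val, mul_zero, zero_mul,
    mul_one, Finset.sum_const_zero, add_zero, zero_add, weylTensor_ksMetric_radial hx hw hw']
  rw [key, Rcx]
  push_cast
  linear_combination ((Rsq a x : ℂ)⁻¹ ^ 3 * w (x 1) * a ^ 2 * Complex.cos (x 2) ^ 2) *
    Complex.I_sq

end Weyl

/-! ### The electromagnetic field -/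

/-- The Kerr-Newman field tensor with `E = √2 e`, where `z = 1 / R²`. -/
def faradayTable (E a r s c z : ℝ) : Matrix (Fin 4) (Fin 4) ℝ :=
  let p := E * (2 * r ^ 2 * z ^ 2 - z)
  let b := 2 * E * a * r * s * c * z ^ 2
  !![0, - p, a * b, 0;
     p, 0, 0, - a * s ^ 2 * p;
     - a * b, 0, 0, (r ^ 2 + a ^ 2) * b;
     0, a * s ^ 2 * p, - (r ^ 2 + a ^ 2) * b, 0]

/-- The `r`-derivatives of `faradayTable`. -/
def faradayTableR (E a r s c z : ℝ) : Matrix (Fin 4) (Fin 4) ℝ :=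
  let zr := - 2 * r * z ^ 2
  let b := 2 * E * a * r * s * c * z ^ 2
  let p' := E * (4 * r * z ^ 2 + 4 * r ^ 2 * z * zr - zr)
  let b' := 2 * E * a * s * c * (z ^ 2 + 2 * r * z * zr)
  !![0, - p', a * b', 0;
     p', 0, 0, - a * s ^ 2 * p';
     - a * b', 0, 0, (r ^ 2 + a ^ 2) * b' + 2 * r * b;
     0, a * s ^ 2 * p', - (r ^ 2 + a ^ 2) * b' - 2 * r * b, 0]

/-- The `θ`-derivatives of `faradayTable`. -/
def faradayTableTheta (E a r s c z : ℝ) : Matrix (Fin 4) (Fin 4) ℝ :=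
  let zt := 2 * a ^ 2 * s * c * z ^ 2
  let p := E * (2 * r ^ 2 * z ^ 2 - z)
  let p' := E * (4 * r ^ 2 * z * zt - zt)
  let b' := 2 * E * a * r * ((c ^ 2 - s ^ 2) * z ^ 2 + 2 * s * c * z * zt)
  !![0, - p', a * b', 0;
     p', 0, 0, - a * s ^ 2 * p' - 2 * a * s * c * p;
     - a * b', 0, 0, (r ^ 2 + a ^ 2) * b';
     0, a * s ^ 2 * p' + 2 * a * s * c * p, - (r ^ 2 + a ^ 2) * b', 0]

/-- The derivatives `∂ᵢ F_{bc}` of `faradayTable`. -/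
def faradayDeriv (E a r s c z : ℝ) (i : Fin 4) : Matrix (Fin 4) (Fin 4) ℝ :=
  (![0, faradayTableR E a r s c z, faradayTableTheta E a r s c z, 0] :
    Fin 4 → Matrix (Fin 4) (Fin 4) ℝ) i

/-- The Kerr-Newman field tensor of the charge `e`. -/
def faradayField (a e : ℝ) : TensorField2 := fun x =>
  faradayTable (Real.sqrt 2 * e) a (x 1) (Real.sin (x 2)) (Real.cos (x 2)) (Rsq a x)⁻¹

theorem hasDerivAt_faradayTable_r {E a r s c : ℝ} {z : ℝ → ℝ}
    (hz : HasDerivAt z (-2 * r * z r ^ 2) r) (i j : Fin 4) :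
    HasDerivAt (fun ρ => faradayTable E a ρ s c (z ρ) i j)
      (faradayTableR E a r s c (z r) i j) r := by
  have hid := hasDerivAt_id' r
  fin_cases i <;> fin_cases j <;>
    simp only [faradayTable, faradayTableR, Fin.zero_eta, Fin.mk_one, Fin.reduceFinMk,
      Matrix.of_apply, Matrix.cons_val', Matrix.cons_val_zero, Matrix.cons_val_one, Matrix.cons_val,
      Matrix.cons_val_fin_one] <;>
    refine HasDerivAt.congr_deriv (by apply_rules [HasDerivAt.fun_pow, HasDerivAt.fun_add,
      HasDerivAt.fun_sub, HasDerivAt.fun_neg, HasDerivAt.fun_mul, hasDerivAt_const]) ?_ <;>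
    (try simp only [Nat.cast_ofNat, Nat.reduceSub, pow_one]) <;> ring

theorem hasDerivAt_faradayTable_theta {E a r θ : ℝ} {z S C : ℝ → ℝ}
    (hz : HasDerivAt z (2 * a ^ 2 * S θ * C θ * z θ ^ 2) θ)
    (hS : HasDerivAt S (C θ) θ) (hC : HasDerivAt C (-S θ) θ) (i j : Fin 4) :
    HasDerivAt (fun ϑ => faradayTable E a r (S ϑ) (C ϑ) (z ϑ) i j)
      (faradayTableTheta E a r (S θ) (C θ) (z θ) i j) θ := by
  fin_cases i <;> fin_cases j <;>
    simp only [faradayTable, faradayTableTheta, Fin.zero_eta, Fin.mk_one, Fin.reduceFinMk,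
      Matrix.of_apply, Matrix.cons_val', Matrix.cons_val_zero, Matrix.cons_val_one, Matrix.cons_val,
      Matrix.cons_val_fin_one] <;>
    refine HasDerivAt.congr_deriv (by apply_rules [HasDerivAt.fun_pow, HasDerivAt.fun_add,
      HasDerivAt.fun_sub, HasDerivAt.fun_neg, HasDerivAt.fun_mul, hasDerivAt_const]) ?_ <;>
    (try simp only [Nat.cast_ofNat, Nat.reduceSub, pow_one]) <;> ring

theorem faraday_closed_algebra {E a r s c z : ℝ} (hz : z * (r ^ 2 + a ^ 2 * c ^ 2) = 1)
    (hc : c ^ 2 = 1 - s ^ 2) (i j k : Fin 4) :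
    faradayDeriv E a r s c z i j k + faradayDeriv E a r s c z j k i
      + faradayDeriv E a r s c z k i j = 0 := by
  rw [hc] at hz
  have hS : r ^ 2 + a ^ 2 * (1 - s ^ 2) ≠ 0 := right_ne_zero_of_mul_eq_one hz
  obtain rfl : z = (r ^ 2 + a ^ 2 * (1 - s ^ 2))⁻¹ := eq_inv_of_mul_eq_one_left hz
  fin_cases i <;> fin_cases j <;> fin_cases k <;>
    simp only [faradayDeriv, faradayTableR, faradayTableTheta, Fin.zero_eta, Fin.mk_one,
      Fin.reduceFinMk, Matrix.of_apply, Matrix.cons_val', Matrix.cons_val_zero,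
      Matrix.cons_val_one, Matrix.cons_val, Matrix.cons_val_fin_one, Matrix.zero_apply,
      add_zero, zero_add, neg_add_cancel, add_neg_cancel] <;>
    field_simp <;> ring_nf

/-- Here `w` and `v` are free variables, absent from the field tensor: the profile cancels from the
divergence altogether. -/
theorem faraday_divergence_algebra {E a r s c t z w v : ℝ}
    (hz : z * (r ^ 2 + a ^ 2 * c ^ 2) = 1) (ht : t * s = 1) (hc : c ^ 2 = 1 - s ^ 2) (B : Fin 4) :
    ∑ A, ∑ C, inverseTable a r s t z w A C *
      (faradayDeriv E a r s c z C A B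
        - ∑ d, gammaTable a r s c t z w v d C A * faradayTable E a r s c z d B
        - ∑ d, gammaTable a r s c t z w v d C B * faradayTable E a r s c z A d) = 0 := by
  have hs : s ≠ 0 := right_ne_zero_of_mul_eq_one ht
  rw [hc] at hz
  have hS : r ^ 2 + a ^ 2 * (1 - s ^ 2) ≠ 0 := right_ne_zero_of_mul_eq_one hz
  obtain rfl : z = (r ^ 2 + a ^ 2 * (1 - s ^ 2))⁻¹ := eq_inv_of_mul_eq_one_left hz
  obtain rfl : t = s⁻¹ := eq_inv_of_mul_eq_one_left ht
  fin_cases B <;>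
    simp only [faradayDeriv, faradayTable, faradayTableR, faradayTableTheta, inverseTable,
      gammaTable, symmMatrix, Fin.sum_univ_four, Fin.zero_eta, Fin.mk_one,
      Fin.reduceFinMk, Matrix.of_apply, Matrix.cons_val', Matrix.cons_val_zero,
      Matrix.cons_val_one, Matrix.cons_val, Matrix.cons_val_fin_one, Matrix.zero_apply,
      mul_zero, zero_mul, add_zero, zero_add, sub_zero, zero_sub, sub_self] <;>
    field_simp <;> ring_nf <;> (try simp only [hc]) <;> (try ring_nf)

theorem stress_algebra {E a r s c t z w : ℝ}
    (hz : z * (r ^ 2 + a ^ 2 * c ^ 2) = 1) (ht : t * s = 1) (hc : c ^ 2 = 1 - s ^ 2) (i j : Fin 4) :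
    let h := (r ^ 2 + a ^ 2 - w) * z / 2
    let l : Fin 4 → ℝ := ![1, 0, 0, - a * s ^ 2]
    let n : Fin 4 → ℝ := ![h, 1, 0, - h * a * s ^ 2]
    1 / 4 * metricTable a r s c z w i j *
        (∑ A, ∑ B, ∑ C, ∑ D, inverseTable a r s t z w A C * inverseTable a r s t z w B D *
          faradayTable E a r s c z A B * faradayTable E a r s c z C D)
      - ∑ A, ∑ B, inverseTable a r s t z w A B * faradayTable E a r s c z i A *
          faradayTable E a r s c z j B
      = E ^ 2 / 2 * z ^ 2 * (2 * (l i * n j + l j * n i) - metricTable a r s c z w i j) := by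
  have hs : s ≠ 0 := right_ne_zero_of_mul_eq_one ht
  rw [hc] at hz
  have hS : r ^ 2 + a ^ 2 * (1 - s ^ 2) ≠ 0 := right_ne_zero_of_mul_eq_one hz
  obtain rfl : z = (r ^ 2 + a ^ 2 * (1 - s ^ 2))⁻¹ := eq_inv_of_mul_eq_one_left hz
  obtain rfl : t = s⁻¹ := eq_inv_of_mul_eq_one_left ht
  have hc4 : c ^ 4 = (1 - s ^ 2) ^ 2 := by rw [← hc]; ring
  -- The invariant `F_{cd}F^{cd}`, a magnetic minus an electric square, is common to all 16
  -- components and is evaluated once.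
  have hsq : ∑ A, ∑ B, ∑ C, ∑ D, inverseTable a r s s⁻¹ (r ^ 2 + a ^ 2 * (1 - s ^ 2))⁻¹ w A C *
      inverseTable a r s s⁻¹ (r ^ 2 + a ^ 2 * (1 - s ^ 2))⁻¹ w B D *
      faradayTable E a r s c (r ^ 2 + a ^ 2 * (1 - s ^ 2))⁻¹ A B *
      faradayTable E a r s c (r ^ 2 + a ^ 2 * (1 - s ^ 2))⁻¹ C D
      = 2 * ((2 * E * a * r * c) ^ 2 * (r ^ 2 + a ^ 2 * (1 - s ^ 2))⁻¹ ^ 4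
        - (E * (2 * r ^ 2 * (r ^ 2 + a ^ 2 * (1 - s ^ 2))⁻¹ ^ 2
          - (r ^ 2 + a ^ 2 * (1 - s ^ 2))⁻¹)) ^ 2) := by
    simp only [faradayTable, inverseTable, Fin.sum_univ_four, Matrix.of_apply, Matrix.cons_val',
      Matrix.cons_val_zero, Matrix.cons_val_one, Matrix.cons_val, Matrix.cons_val_fin_one,
      mul_zero, zero_mul, add_zero, zero_add]
    field_simp
    ring
  rw [hsq]
  fin_cases i <;> fin_cases j <;>
    simp only [metricTable, faradayTable, inverseTable, Fin.sum_univ_four, Fin.zero_eta,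
      Fin.mk_one, Fin.reduceFinMk, Matrix.of_apply, Matrix.cons_val', Matrix.cons_val_zero,
      Matrix.cons_val_one, Matrix.cons_val, Matrix.cons_val_fin_one, mul_zero, zero_mul, add_zero,
      zero_add, zero_sub, sub_self] <;>
    field_simp <;> ring_nf <;> (try simp only [hc, hc4]) <;> (try ring_nf)

/-! ### Maxwell scalars and Einstein's equations -/

section EinsteinMaxwell

variable {a Λ M e : ℝ} {q w w' w'' : ℝ → ℝ} {x : Event}

theorem pderivAt_faradayField (hx : x ∈ coordDomain) (i j k : Fin 4) :
    pderivAt i (fun y => faradayField a e y j k) x =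
      faradayDeriv (Real.sqrt 2 * e) a (x 1) (Real.sin (x 2)) (Real.cos (x 2)) (Rsq a x)⁻¹
        i j k := by
  have hS := (Rsq_pos (a := a) hx).ne'
  rw [pderivAt_of_hasDerivAt (F := fun ρ ϑ => faradayTable (Real.sqrt 2 * e) a ρ (Real.sin ϑ)
    (Real.cos ϑ) (ρ ^ 2 + a ^ 2 * Real.cos ϑ ^ 2)⁻¹ j k) ?_
    (hasDerivAt_faradayTable_r (hasDerivAt_inv_Rsq_r hS) j k)
    (hasDerivAt_faradayTable_theta (hasDerivAt_inv_Rsq_theta hS) (Real.hasDerivAt_sin _)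
      (Real.hasDerivAt_cos _) j k)]
  · fin_cases i <;> rfl
  · exact Eventually.of_forall fun y => rfl

theorem contDiffOn_faradayField (i j : Fin 4) :
    ContDiffOn ℝ (⊤ : ℕ∞) (fun x => faradayField a e x i j) coordDomain := by
  have hz : ContDiffOn ℝ (⊤ : ℕ∞) (fun x : Event => (Rsq a x)⁻¹) coordDomain :=
    ContDiffOn.inv (by unfold Rsq; fun_prop) fun x hx => (Rsq_pos hx).ne'
  fin_cases i <;> fin_cases j <;>
    simp only [faradayField, faradayTable, Fin.zero_eta, Fin.mk_one, Fin.reduceFinMk,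
      Matrix.of_apply, Matrix.cons_val', Matrix.cons_val_zero, Matrix.cons_val_one, Matrix.cons_val,
      Matrix.cons_val_fin_one] <;> fun_prop

theorem isMaxwellFieldOn_faradayField (hw : ∀ r, 0 < r → HasDerivAt w (w' r) r) :
    IsMaxwellFieldOn (ksMetric a w) (faradayField a e) coordDomain where
  smooth := contDiffOn_faradayField
  antisymm x _ i j := by
    fin_cases i <;> fin_cases j <;> simp [faradayField, faradayTable] <;> ring
  closed x hx i j k := by
    simp only [pderivAt_faradayField hx]
    exact faraday_closed_algebra (inv_Rsq_mul hx) (Real.cos_sq' _) i j k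
  divergence_free x hx j := by
    simp only [pderivAt_faradayField hx, ksMetric_inv hx, christoffel_ksMetric hx (hw _ hx.1)]
    exact faraday_divergence_algebra (inv_Rsq_mul hx) (inv_sin_mul hx) (Real.cos_sq' _) j

theorem npPhi0_faradayField (hx : x ∈ coordDomain) :
    npPhi0 (ksMetric a w) (faradayField a e) (tetradL a x) (tetradM a x) x = 0 := by
  have ht := congrArg ((↑) : ℝ → ℂ) (inv_sin_mul hx)
  simp only [npPhi0, raiseIndex_tetradL hx, raiseIndex_tetradM hx, faradayField, faradayTable]
  generalize (Rsq a x)⁻¹ = z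
  generalize (Real.sin (x 2))⁻¹ = t at *
  generalize Real.sin (x 2) = s at *
  push_cast at ht
  generalize tetradFactor a x = k at *
  simp [Fin.sum_univ_four]
  linear_combination (k * Complex.I * a * s * ((Real.sqrt 2 : ℂ) * e *
    (2 * (x 1 : ℂ) ^ 2 * z ^ 2 - z))) * ht

theorem npPhi2_faradayField (hx : x ∈ coordDomain)
    (hD : DeltaStar a Λ M q x = x 1 ^ 2 + a ^ 2 - w (x 1)) :
    npPhi2 (ksMetric a w) (faradayField a e) (tetradN a Λ M q x) (tetradM a x) x = 0 := by
  have ht := congrArg ((↑) : ℝ → ℂ) (inv_sin_mul hx)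
  simp only [npPhi2, raiseIndex_conjCovector, raiseIndex_tetradN hx hD, raiseIndex_tetradM hx,
    faradayField, faradayTable]
  generalize (Rsq a x)⁻¹ = z
  generalize (Real.sin (x 2))⁻¹ = t at *
  generalize Real.sin (x 2) = s at *
  push_cast at ht
  generalize tetradFactor a x = k at *
  simp only [Fin.sum_univ_four, Matrix.of_apply, Matrix.cons_val', Matrix.cons_val_zero,
    Matrix.cons_val_one, Matrix.cons_val, Matrix.cons_val_fin_one, map_mul, map_neg, map_zero,
    Complex.conj_I, Complex.conj_ofReal]
  push_cast
  generalize starRingEnd ℂ k = k'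
  linear_combination (k' * Complex.I * a * s * ((Real.sqrt 2 : ℂ) * e *
    (2 * (x 1 : ℂ) ^ 2 * z ^ 2 - z)) * (-((x 1 : ℂ) ^ 2 + a ^ 2 - w (x 1)) * z / 2)) * ht

theorem npPhi1_faradayField (hx : x ∈ coordDomain)
    (hD : DeltaStar a Λ M q x = x 1 ^ 2 + a ^ 2 - w (x 1)) :
    npPhi1 (ksMetric a w) (faradayField a e) (tetradL a x) (tetradN a Λ M q x) (tetradM a x) x
      = (e : ℂ) / ((Real.sqrt 2 : ℂ) * (starRingEnd ℂ (Rcx a x)) ^ 2) := by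
  have h2 : (Real.sqrt 2 : ℂ) * (Real.sqrt 2 : ℂ) = 2 := by
    exact_mod_cast Real.mul_self_sqrt (by norm_num : (0 : ℝ) ≤ 2)
  have h20 : (Real.sqrt 2 : ℂ) ≠ 0 := by simp
  have hR : Rcx a x * starRingEnd ℂ (Rcx a x) * ((Rsq a x)⁻¹ : ℝ) = 1 := by
    rw [Rcx_mul_conj]
    exact_mod_cast mul_inv_cancel₀ (Rsq_pos (a := a) hx).ne'
  have hz := inv_Rsq_mul (a := a) hx
  have ht := inv_sin_mul hx
  have hc := Real.cos_sq' (x 2)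
  have hk := tetradFactor_mul_conj (a := a) (x := x)
  -- Without `R̄` in a denominator the value is `(e/√2)(zR)²`, polynomial in `z` and `R`; `zR R̄ =
  -- 1` then gives the stated quotient.
  have key : npPhi1 (ksMetric a w) (faradayField a e) (tetradL a x) (tetradN a Λ M q x)
      (tetradM a x) x = (Real.sqrt 2 : ℂ) / 2 * e * (((Rsq a x)⁻¹ : ℝ) : ℂ) ^ 2 * Rcx a x ^ 2 := by
    simp only [npPhi1, raiseIndex_conjCovector, raiseIndex_tetradL hx, raiseIndex_tetradN hx hD,
      raiseIndex_tetradM hx, faradayField, faradayTable, Rcx]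
    generalize (Rsq a x)⁻¹ = z at *
    generalize Real.sin (x 2) = s at *
    generalize Real.cos (x 2) = c at *
    generalize s⁻¹ = t at *
    have hz := congrArg ((↑) : ℝ → ℂ) hz
    have ht := congrArg ((↑) : ℝ → ℂ) ht
    have hc := congrArg ((↑) : ℝ → ℂ) hc
    push_cast at hz hc hk ht
    generalize tetradFactor a x = k at *
    simp only [Fin.sum_univ_four, Matrix.of_apply, Matrix.cons_val', Matrix.cons_val_zero,
      Matrix.cons_val_one, Matrix.cons_val, Matrix.cons_val_fin_one, map_mul, map_neg, map_zero,
      Complex.conj_I, Complex.conj_ofReal]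
    push_cast
    generalize starRingEnd ℂ k = k' at *
    linear_combination
      ((Real.sqrt 2 : ℂ) * e * (2 * (x 1 : ℂ) ^ 2 * z ^ 2 - z) / 2) * (hz - (z : ℂ) * a ^ 2 * hc)
      + (Complex.I * (2 * (Real.sqrt 2 * e) * a * (x 1 : ℂ) * s * c * z ^ 2) *
        (((x 1 : ℂ) ^ 2 + a ^ 2) * t - a ^ 2 * s)) * hk
      + (Complex.I * ((Real.sqrt 2 * e) * a * (x 1 : ℂ) * c * z ^ 2) * z *
        ((x 1 : ℂ) ^ 2 + a ^ 2)) * ht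
      + (Complex.I * ((Real.sqrt 2 * e) * a * (x 1 : ℂ) * c * z ^ 2)) *
        (hz - (z : ℂ) * a ^ 2 * hc)
      + ((Real.sqrt 2 : ℂ) / 2 * e * z) * hz
      - ((Real.sqrt 2 : ℂ) / 2 * e * (a * c) ^ 2 * z ^ 2) * Complex.I_sq
  rw [key, eq_div_iff (mul_ne_zero h20 (pow_ne_zero _ (conj_Rcx_ne_zero hx)))]
  generalize (((Rsq a x)⁻¹ : ℝ) : ℂ) = z at *
  generalize starRingEnd ℂ (Rcx a x) = R' at *
  linear_combination (e * z ^ 2 * Rcx a x ^ 2 * R' ^ 2 / 2) * h2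
    + e * (Rcx a x * R' * z + 1) * hR

theorem tetradL_eq_ofReal (i : Fin 4) :
    tetradL a x i = ((![1, 0, 0, - a * Real.sin (x 2) ^ 2] : Fin 4 → ℝ) i : ℂ) := by
  fin_cases i <;> simp [tetradL]

theorem tetradN_eq_ofReal (hD : DeltaStar a Λ M q x = x 1 ^ 2 + a ^ 2 - w (x 1)) (i : Fin 4) :
    tetradN a Λ M q x i = ((let h := (x 1 ^ 2 + a ^ 2 - w (x 1)) * (Rsq a x)⁻¹ / 2
      (![h, 1, 0, - h * a * Real.sin (x 2) ^ 2] : Fin 4 → ℝ) i : ℝ) : ℂ) := by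
  fin_cases i <;>
    simp only [tetradN, hD, Fin.zero_eta, Fin.mk_one, Fin.reduceFinMk, Matrix.cons_val_zero,
      Matrix.cons_val_one, Matrix.cons_val] <;>
    push_cast <;> ring

theorem cosmologicalStress_eq_ofReal (hx : x ∈ coordDomain)
    (hD : DeltaStar a Λ M q x = x 1 ^ 2 + a ^ 2 - w (x 1)) (i j : Fin 4) :
    cosmologicalStress a Λ M q i j x =
      ((let h := (x 1 ^ 2 + a ^ 2 - w (x 1)) * (Rsq a x)⁻¹ / 2
        let l : Fin 4 → ℝ := ![1, 0, 0, - a * Real.sin (x 2) ^ 2]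
        let n : Fin 4 → ℝ := ![h, 1, 0, - h * a * Real.sin (x 2) ^ 2]
        Λ * x 1 ^ 4 / Rsq a x ^ 2 * (l i * n j + l j * n i)
          + - Λ * x 1 ^ 2 * (x 1 ^ 2 + 2 * a ^ 2 * Real.cos (x 2) ^ 2) / Rsq a x ^ 2 *
            (l i * n j + l j * n i - metricTable a (x 1) (Real.sin (x 2)) (Real.cos (x 2))
              (Rsq a x)⁻¹ (w (x 1)) i j) : ℝ) : ℂ) := by
  simp only [cosmologicalStress]
  rw [tetradM_mul_conj_add (w := w) i j hx]
  simp only [tetradL_eq_ofReal, tetradN_eq_ofReal hD]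
  push_cast
  ring

/-- Each side is a combination of `ℓ ⊗ n + n ⊗ ℓ` and `g`. In the coefficients, `w - rw' = -(e² +
Λr⁴)` and `w'' = 4Λr²` do not contain the mass; `e²` is the Maxwell part and the terms in Λ are the
cosmological one. -/
theorem einstein_ksMetric (hx : x ∈ coordDomain)
    (hwx : w (x 1) = 2 * M * x 1 - e ^ 2 + Λ * x 1 ^ 4 / 3)
    (hw : ∀ r, 0 < r → HasDerivAt w (w' r) r)
    (hw' : HasDerivAt w' (w'' (x 1)) (x 1)) (hv : w' (x 1) = 2 * M + 4 * Λ * x 1 ^ 3 / 3)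
    (hv' : w'' (x 1) = 4 * Λ * x 1 ^ 2)
    (hD : DeltaStar a Λ M q x = x 1 ^ 2 + a ^ 2 - w (x 1)) (i j : Fin 4) :
    ((einsteinTensor (ksMetric a w) i j x : ℝ) : ℂ) =
      - (((maxwellStress (ksMetric a w) (faradayField a e) i j x : ℝ) : ℂ)
        + cosmologicalStress a Λ M q i j x) := by
  have hz := inv_Rsq_mul (a := a) hx
  have hE : (Real.sqrt 2 * e) ^ 2 / 2 = e ^ 2 := by
    rw [mul_pow, Real.sq_sqrt (by norm_num)]
    ring
  rw [cosmologicalStress_eq_ofReal hx hD]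
  norm_cast
  simp only [einsteinTensor, maxwellStress, ricciTensor_ksMetric hx hw hw',
    scalarCurv_ksMetric hx hw hw', ksMetric_inv hx]
  simp only [ksMetric_eq_metricTable hx, faradayField]
  rw [stress_algebra hz (inv_sin_mul hx) (Real.cos_sq' _), hE]
  simp only [ricciTable, hv, hv', div_eq_mul_inv, ← inv_pow]
  rw [div_eq_mul_inv] at hwx
  -- Only coefficients are compared, so `g`, `l` and `n` may be arbitrary.
  generalize metricTable a (x 1) _ _ _ _ i j = g
  generalize (![1, 0, 0, -a * Real.sin (x 2) ^ 2] : Fin 4 → ℝ) = l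
  generalize (![(x 1 ^ 2 + a ^ 2 - w (x 1)) * (Rsq a x)⁻¹ * 2⁻¹, 1, 0,
    -((x 1 ^ 2 + a ^ 2 - w (x 1)) * (Rsq a x)⁻¹ * 2⁻¹) * a * Real.sin (x 2) ^ 2] : Fin 4 → ℝ) = n
  linear_combination (2 * (l i * n j + l j * n i) - g) * (Rsq a x)⁻¹ ^ 2 * hwx
    - 2 * Λ * x 1 ^ 2 * (Rsq a x)⁻¹ * (l i * n j + l j * n i - g) * hz

end EinsteinMaxwell

/-! ### Constant charge -/

section ConstantCharge

variable {a Λ M e : ℝ} {x : Event}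

/-- The Kerr-Schild profile of the metric with mass `M` and constant charge `e`. -/
def chargedProfile (Λ M e : ℝ) (r : ℝ) : ℝ := 2 * M * r - e ^ 2 + Λ * r ^ 4 / 3

theorem hasDerivAt_chargedProfile (r : ℝ) :
    HasDerivAt (chargedProfile Λ M e) (2 * M + 4 * Λ * r ^ 3 / 3) r := by
  refine ((((hasDerivAt_id' r).const_mul (2 * M)).sub_const (e ^ 2)).fun_add
    ((((hasDerivAt_id' r).fun_pow 4).const_mul Λ).div_const 3)).congr_deriv ?_
  norm_num
  ring

theorem hasDerivAt_deriv_chargedProfile (r : ℝ) :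
    HasDerivAt (fun r => 2 * M + 4 * Λ * r ^ 3 / 3) (4 * Λ * r ^ 2) r := by
  refine (((((hasDerivAt_id' r).fun_pow 3).const_mul (4 * Λ)).div_const 3).const_add
    (2 * M)).congr_deriv ?_
  norm_num
  ring

theorem kndsMetric_const_eq :
    kndsMetric a Λ M (fun _ => e) = ksMetric a (chargedProfile Λ M e) :=
  kndsMetric_eq_ksMetric a Λ M _

theorem deltaStar_const_eq :
    DeltaStar a Λ M (fun _ => e) x = x 1 ^ 2 + a ^ 2 - chargedProfile Λ M e (x 1) := by
  unfold DeltaStar chargedProfile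
  ring

theorem npLambda_kndsMetric_const (hx : x ∈ coordDomain) :
    npLambda (kndsMetric a Λ M (fun _ => e)) x = Λ * x 1 ^ 2 / (6 * Rsq a x) := by
  have hS := (Rsq_pos (a := a) hx).ne'
  rw [npLambda, kndsMetric_const_eq, scalarCurv_ksMetric (w'' := fun r => 4 * Λ * r ^ 2) hx
    (fun r _ => hasDerivAt_chargedProfile r) (hasDerivAt_deriv_chargedProfile (x 1))]
  field_simp
  ring

theorem lambdaC_eq (hx : x ∈ coordDomain) : lambdaC a Λ x = Λ * x 1 ^ 2 / (6 * Rsq a x) :=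
  npLambda_kndsMetric_const hx

theorem einstein_kndsMetric_const (hx : x ∈ coordDomain) (i j : Fin 4) :
    ((einsteinTensor (kndsMetric a Λ M (fun _ => e)) i j x : ℝ) : ℂ) =
      - (((maxwellStress (kndsMetric a Λ M (fun _ => e)) (faradayField a e) i j x : ℝ) : ℂ)
        + cosmologicalStress a Λ M (fun _ => e) i j x) := by
  rw [kndsMetric_const_eq]
  exact einstein_ksMetric (w'' := fun r => 4 * Λ * r ^ 2) hx rfl (fun r _ => hasDerivAt_chargedProfile r)
    (hasDerivAt_deriv_chargedProfile (x 1)) rfl rfl deltaStar_const_eq i j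

theorem npPsi2_kndsMetric_const (hx : x ∈ coordDomain) :
    npPsi2 (kndsMetric a Λ M (fun _ => e)) (tetradL a x) (tetradN a Λ M (fun _ => e) x)
        (tetradM a x) x =
      1 / ((starRingEnd ℂ (Rcx a x)) ^ 2 * (Rsq a x : ℂ)) *
        (- (M : ℂ) * Rcx a x + (e : ℂ) ^ 2 +
          ((Λ * x 1 ^ 2 / 3 * a ^ 2 * Real.cos (x 2) ^ 2 : ℝ) : ℂ)) := by
  have hS : (Rsq a x : ℂ) ≠ 0 := by exact_mod_cast (Rsq_pos (a := a) hx).ne'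
  have hR := conj_Rcx_ne_zero (a := a) hx
  -- Turns the powers of `zR` in `npPsi2_ksMetric` into the denominators `R̄` and `R̄²`.
  have hinv : (Rsq a x : ℂ)⁻¹ * Rcx a x = (starRingEnd ℂ (Rcx a x))⁻¹ := by
    rw [← Rcx_mul_conj, mul_inv, mul_assoc, mul_comm _ (Rcx a x), ← mul_assoc,
      inv_mul_cancel₀ (Rcx_ne_zero hx), one_mul]
  rw [kndsMetric_const_eq, npPsi2_ksMetric (w'' := fun r => 4 * Λ * r ^ 2) hx
    (fun r _ => hasDerivAt_chargedProfile r) (hasDerivAt_deriv_chargedProfile (x 1)) deltaStar_const_eq, mul_assoc _ _ (Rcx a x), hinv]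
  have h1 : Rcx a x = (x 1 : ℂ) + Complex.I * (a : ℂ) * (Real.cos (x 2) : ℂ) := rfl
  have h2 : starRingEnd ℂ (Rcx a x) = (x 1 : ℂ) - Complex.I * (a : ℂ) * (Real.cos (x 2) : ℂ) := by
    rw [h1]
    simp [-Complex.ofReal_cos]
    ring
  rw [chargedProfile]
  push_cast
  generalize starRingEnd ℂ (Rcx a x) = R' at *
  generalize (Rsq a x : ℂ) = S at *
  field_simp
  rw [h1, h2]
  push_cast
  linear_combination (-12 * Λ * (x 1 : ℂ) ^ 2 * a ^ 2 * Complex.cos (x 2) ^ 2) * Complex.I_sq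

end ConstantCharge

/-! ### Variable charge -/

section VariableCharge

variable {a Λ M e : ℝ} {q : ℝ → ℝ}

theorem hasDerivAt_of_contDiffOn_two {f : ℝ → ℝ} (hf : ContDiffOn ℝ 2 f (Set.Ioi 0)) {r : ℝ}
    (hr : 0 < r) : HasDerivAt f (deriv f r) r :=
  ((hf.differentiableOn (by norm_num)).differentiableAt (Ioi_mem_nhds hr)).hasDerivAt

theorem hasDerivAt_deriv_of_contDiffOn_two {f : ℝ → ℝ} (hf : ContDiffOn ℝ 2 f (Set.Ioi 0)) {r : ℝ}
    (hr : 0 < r) : HasDerivAt (deriv f) (deriv (deriv f) r) r := by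
  have h : ContDiffOn ℝ 1 (deriv f) (Set.Ioi 0) :=
    hf.deriv_of_isOpen isOpen_Ioi (by norm_num)
  exact ((h.differentiableOn (by norm_num)).differentiableAt (Ioi_mem_nhds hr)).hasDerivAt

/-- The second derivative of the profile is `4Λr² - (q²)''`, and the de Sitter metric accounts for
`4Λr²`. -/
theorem lambdaE_eq (hq : ContDiffOn ℝ 2 q (Set.Ioi 0)) {x : Event} (hx : x ∈ coordDomain) :
    lambdaE a Λ M q x = - deriv (deriv fun r => q r ^ 2) (x 1) / (24 * Rsq a x) := by
  have hS := (Rsq_pos (a := a) hx).ne'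
  have hf : ContDiffOn ℝ 2 (fun r => q r ^ 2) (Set.Ioi 0) := hq.pow 2
  have hw : ∀ r, 0 < r → HasDerivAt (fun r => 2 * M * r - q r ^ 2 + Λ * r ^ 4 / 3)
      (2 * M + 4 * Λ * r ^ 3 / 3 - deriv (fun r => q r ^ 2) r) r := fun r hr => by
    refine ((hasDerivAt_chargedProfile (Λ := Λ) (M := M) (e := 0) r).fun_sub
      (hasDerivAt_of_contDiffOn_two hf hr)).congr_of_eventuallyEq (.of_forall fun y => ?_)
    simp only [chargedProfile]
    ring
  have hw' := (hasDerivAt_deriv_chargedProfile (Λ := Λ) (M := M) (x 1)).fun_sub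
    (hasDerivAt_deriv_of_contDiffOn_two hf hx.1)
  rw [lambdaE, lambdaC_eq hx, npLambda, kndsMetric_eq_ksMetric,
    scalarCurv_ksMetric (w'' := fun r => 4 * Λ * r ^ 2 - deriv (deriv fun r => q r ^ 2) r) hx hw hw']
  field_simp
  ring

theorem affine_iff_deriv_deriv_eq_zero {f : ℝ → ℝ} (hf : ContDiffOn ℝ 2 f (Set.Ioi 0)) :
    (∀ r, 0 < r → deriv (deriv f) r = 0) ↔ ∃ m C : ℝ, ∀ r, 0 < r → f r = 2 * r * m + C := by
  constructor
  · intro h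
    obtain ⟨b, hb⟩ := isOpen_Ioi.exists_is_const_of_deriv_eq_zero isPreconnected_Ioi
      (fun r hr => (hasDerivAt_deriv_of_contDiffOn_two hf hr).differentiableAt.differentiableWithinAt)
      (fun r hr => h r hr)
    -- Second integration on the connected half-line; the slope `b` is `2m`, whence the witness `b /
    -- 2`.
    have hd : ∀ r, 0 < r → HasDerivAt (fun r => f r - b * r) 0 r := fun r hr => by
      refine ((hasDerivAt_of_contDiffOn_two hf hr).fun_sub
        ((hasDerivAt_id' r).const_mul b)).congr_deriv ?_
      rw [hb r hr]
      ring
    obtain ⟨C, hC⟩ := isOpen_Ioi.exists_is_const_of_deriv_eq_zero isPreconnected_Ioi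
      (fun r hr => (hd r hr).differentiableAt.differentiableWithinAt)
      (fun r hr => (hd r hr).deriv)
    refine ⟨b / 2, C, fun r hr => ?_⟩
    linarith [hC r hr]
  · rintro ⟨m, C, h⟩ r hr
    have h1 : ∀ r, 0 < r → deriv f r = 2 * m := fun r hr => by
      have : f =ᶠ[𝓝 r] fun r => 2 * r * m + C := by
        filter_upwards [Ioi_mem_nhds hr] with y hy using h y hy
      rw [this.deriv_eq]
      refine ((((hasDerivAt_id' r).const_mul 2).mul_const m).add_const C).deriv.trans (by ring)
    have : deriv f =ᶠ[𝓝 r] fun _ => 2 * m := by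
      filter_upwards [Ioi_mem_nhds hr] with y hy using h1 y hy
    rw [this.deriv_eq, deriv_const]

theorem lambdaE_eq_zero_iff (hq : ContDiffOn ℝ 2 q (Set.Ioi 0)) :
    (∀ x ∈ coordDomain, lambdaE a Λ M q x = 0) ↔
      ∃ m C : ℝ, ∀ r, 0 < r → q r ^ 2 = 2 * r * m + C := by
  rw [← affine_iff_deriv_deriv_eq_zero (hq.pow 2)]
  constructor
  · intro h r hr
    -- One point for each radius suffices, because the numerator depends on `r` alone.
    have hx : ![0, r, Real.pi / 2, 0] ∈ coordDomain :=
      ⟨hr, by simp [Real.pi_pos], by simp [Real.pi_pos]⟩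
    have := h _ hx
    rw [lambdaE_eq hq hx, div_eq_zero_iff, neg_eq_zero] at this
    exact this.resolve_right (mul_ne_zero (by norm_num) (Rsq_pos hx).ne')
  · intro h x hx
    rw [lambdaE_eq hq hx, h _ hx.1, neg_zero, zero_div]

/-- A variable charge with `q(r)² = 2 r m + e²` acts as a shift of the mass by `m`. -/
theorem kndsMetric_eq_of_sq_eq {m : ℝ} (h : ∀ r, 0 < r → q r ^ 2 = 2 * r * m + e ^ 2)
    {x : Event} (hx : x ∈ coordDomain) :
    kndsMetric a Λ M q x = kndsMetric a Λ (M - m) (fun _ => e) x := by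
  have h1 : 2 * M * x 1 - q (x 1) ^ 2 + Λ * x 1 ^ 4 / 3
      = 2 * (M - m) * x 1 - e ^ 2 + Λ * x 1 ^ 4 / 3 := by
    rw [h _ hx.1]
    ring
  rw [kndsMetric_eq_ksMetric, kndsMetric_eq_ksMetric]
  simp only [ksMetric, h1]

/-- The limit at 0 identifies the constant term. A negative slope would make a square negative at
large `r`; slope zero would force `q` to be constant. -/
theorem IsElectricalRadiation.exists_mass (he : e ≠ 0) (h : IsElectricalRadiation a Λ e M q) :
    ∃ m : ℝ, 0 < m ∧ ∀ r, 0 < r → q r ^ 2 = 2 * r * m + e ^ 2 := by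
  obtain ⟨m, C, hm⟩ := (lambdaE_eq_zero_iff h.smooth).1 h.lambdaE_eq_zero
  have hlim : Tendsto (fun r : ℝ => q r ^ 2) (𝓝[>] 0) (𝓝 C) := by
    have h0 : Tendsto (fun r : ℝ => 2 * r * m + C) (𝓝[>] 0) (𝓝 C) := by
      have : Continuous fun r : ℝ => 2 * r * m + C := by fun_prop
      simpa using (this.tendsto 0).mono_left nhdsWithin_le_nhds
    refine h0.congr' ?_
    filter_upwards [self_mem_nhdsWithin] with r hr using (hm r hr).symm
  obtain rfl : C = e ^ 2 := tendsto_nhds_unique hlim h.charge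
  refine ⟨m, ?_, hm⟩
  by_contra! hle
  rcases hle.lt_or_eq with hlt | rfl
  -- The radius at which `2rm + e² = -1`.
  · have hr : 0 < (e ^ 2 + 1) / (-(2 * m)) := by
      apply div_pos (by positivity) (by linarith)
    have h1 := hm _ hr
    have h2 : 2 * ((e ^ 2 + 1) / (-(2 * m))) * m = - (e ^ 2 + 1) := by
      have := hlt.ne
      field_simp
    nlinarith [sq_nonneg (q ((e ^ 2 + 1) / (-(2 * m))))]
  · apply h.variable_charge
    have hsq : ∀ r ∈ Set.Ioi (0 : ℝ), q r ^ 2 = e ^ 2 := fun r hr => by simpa using hm r hr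
    -- As `e ≠ 0`, a continuous `q` with `q² = e²` cannot change sign on a connected set.
    have := isPreconnected_Ioi.eq_or_eq_neg_of_sq_eq (f := q) (g := fun _ => e)
      h.smooth.continuousOn continuousOn_const (fun r hr => hsq r hr) (fun _ => he)
    rcases this with h' | h'
    · exact ⟨e, fun r hr => h' hr⟩
    · exact ⟨-e, fun r hr => h' hr⟩

theorem isElectricalRadiation_sqrt (he : e ≠ 0) {m : ℝ} (hm : 0 < m) :
    IsElectricalRadiation a Λ e M (fun r => Real.sqrt (2 * r * m + e ^ 2)) := by
  have hpos : ∀ r : ℝ, 0 < r → 0 < 2 * r * m + e ^ 2 := fun r hr => by positivity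
  have hs : ContDiffOn ℝ 2 (fun r => Real.sqrt (2 * r * m + e ^ 2)) (Set.Ioi 0) :=
    ContDiffOn.sqrt (by fun_prop) fun r hr => (hpos r hr).ne'
  have hsq : ∀ r : ℝ, 0 < r → Real.sqrt (2 * r * m + e ^ 2) ^ 2 = 2 * r * m + e ^ 2 :=
    fun r hr => Real.sq_sqrt (hpos r hr).le
  refine ⟨hs, ?_, (lambdaE_eq_zero_iff hs).2 ⟨m, e ^ 2, hsq⟩, ?_⟩
  · rintro ⟨c, hc⟩
    have h1 := hsq 1 one_pos
    have h2 := hsq 2 two_pos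
    rw [hc 1 one_pos] at h1
    rw [hc 2 two_pos] at h2
    linarith
  · have h0 : Tendsto (fun r : ℝ => 2 * r * m + e ^ 2) (𝓝[>] 0) (𝓝 (e ^ 2)) := by
      have : Continuous fun r : ℝ => 2 * r * m + e ^ 2 := by fun_prop
      simpa using (this.tendsto 0).mono_left nhdsWithin_le_nhds
    refine h0.congr' ?_
    filter_upwards [self_mem_nhdsWithin] with r hr using (hsq r hr).symm

theorem exists_isRadiationProcess (he : e ≠ 0) {m : ℕ → ℝ} (hm : ∀ k, 0 < m k) :
    ∃ (mass : ℕ → ℝ) (q : ℕ → ℝ → ℝ), IsRadiationProcess a Λ e M mass q ∧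
      ∀ k, mass k = M - ∑ j ∈ Finset.range k, m j := by
  refine ⟨fun k => M - ∑ j ∈ Finset.range k, m j,
    fun k r => Real.sqrt (2 * r * m k + e ^ 2), ⟨by simp,
    fun k => isElectricalRadiation_sqrt he (hm k), fun k x hx => ?_⟩, fun k => rfl⟩
  rw [kndsMetric_eq_of_sq_eq (m := m k) (e := e) (fun r hr => Real.sq_sqrt ?_) hx,
    Finset.sum_range_succ, sub_sub]
  have := hm k
  positivity

/-- The `du²` coefficient at one point with `r > 0` already determines the mass. -/
theorem mass_eq_of_kndsMetric_eq {M' : ℝ} {x : Event} (hx : x ∈ coordDomain)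
    (h : kndsMetric a Λ M (fun _ => e) x = kndsMetric a Λ M' (fun _ => e) x) : M = M' := by
  have hS := (Rsq_pos (a := a) hx).ne'
  have h00 := congrFun (congrFun h 0) 0
  simp only [kndsMetric, Matrix.of_apply, Matrix.cons_val', Matrix.cons_val_zero,
    Matrix.cons_val_fin_one] at h00
  have h1 := (div_left_inj' hS).1 (sub_right_injective h00)
  have h2 : 2 * x 1 * (M - M') = 0 := by linarith
  have := hx.1
  rcases mul_eq_zero.1 h2 with h3 | h3
  · linarith
  · linarith

theorem IsRadiationProcess.mass_succ_lt (he : e ≠ 0) {mass : ℕ → ℝ} {q : ℕ → ℝ → ℝ}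
    (h : IsRadiationProcess a Λ e M mass q) (k : ℕ) : mass (k + 1) < mass k := by
  obtain ⟨m, hm, hq⟩ := (h.radiation k).exists_mass he
  have hx : ![0, 1, Real.pi / 2, 0] ∈ coordDomain :=
    ⟨by simp, by simp [Real.pi_pos], by simp [Real.pi_pos]⟩
  have := mass_eq_of_kndsMetric_eq hx ((kndsMetric_eq_of_sq_eq hq hx).symm.trans (h.next k _ hx))
  linarith

theorem negMassMetric_eq (a Λ μ e : ℝ) :
    negMassMetric a Λ μ e = kndsMetric a Λ (-μ) (fun _ => e) := by
  funext x
  ext i j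
  fin_cases i <;> fin_cases j <;>
    simp only [negMassMetric, kndsMetric, DeltaStar, Fin.zero_eta, Fin.mk_one, Fin.reduceFinMk,
      Matrix.of_apply, Matrix.cons_val', Matrix.cons_val_zero, Matrix.cons_val_one,
      Matrix.cons_val, Matrix.cons_val_fin_one] <;>
    ring

theorem tendsto_kndsMetric_mass {mass : ℕ → ℝ} {m : ℝ} (h : Tendsto mass atTop (𝓝 m)) (x : Event) :
    Tendsto (fun n => kndsMetric a Λ (mass n) q x) atTop (𝓝 (kndsMetric a Λ m q x)) := by
  have hc : Continuous fun m => kndsMetric a Λ m q x := by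
    refine continuous_matrix fun i j => ?_
    fin_cases i <;> fin_cases j <;> simp [kndsMetric, DeltaStar] <;> fun_prop
  exact (hc.tendsto m).comp h

theorem kndsMetric_zero_rotation (Λ M : ℝ) (q : ℝ → ℝ) {x : Event} (hx : x ∈ coordDomain) :
    kndsMetric 0 Λ M q x = rndsMetric Λ M q x := by
  have hr := hx.1.ne'
  ext i j
  fin_cases i <;> fin_cases j <;> simp [kndsMetric, rndsMetric, Rsq] <;> field_simp
  ring

end VariableCharge

/-! ### The naked singularity -/

section NakedSingularity

variable {a Λ M μ e : ℝ}

/-- The second of the two squares is enough: in `e² + Λr⁴` both terms have one sign and the mass has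
cancelled. The bound depends on `R²` only, so blow-up holds along every approach to `R² = 0`. -/
theorem ricciSquared_kndsMetric_const_ge {x : Event} (hΛ : 0 < Λ) (hx : x ∈ coordDomain) :
    2 * e ^ 4 * (Rsq a x)⁻¹ ^ 4 ≤ ricciSquared (kndsMetric a Λ M (fun _ => e)) x := by
  have hS := inv_pos.2 (Rsq_pos (a := a) hx)
  rw [kndsMetric_const_eq, ricciSquared_ksMetric (w'' := fun r => 4 * Λ * r ^ 2) hx
    (fun r _ => hasDerivAt_chargedProfile r) (hasDerivAt_deriv_chargedProfile (x 1))]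
  have h : chargedProfile Λ M e (x 1) - x 1 * (2 * M + 4 * Λ * x 1 ^ 3 / 3)
      = - (e ^ 2 + Λ * x 1 ^ 4) := by
    unfold chargedProfile
    ring
  rw [h]
  have h1 : (e ^ 2) ^ 2 ≤ (e ^ 2 + Λ * x 1 ^ 4) ^ 2 :=
    pow_le_pow_left₀ (by positivity) (by linarith [show 0 ≤ Λ * x 1 ^ 4 by positivity]) 2
  have h2 := mul_le_mul_of_nonneg_right h1 (show 0 ≤ 2 * (Rsq a x)⁻¹ ^ 4 by positivity)
  refine le_trans (le_trans (le_of_eq ?_) (h2.trans (le_of_eq ?_)))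
    (le_add_of_nonneg_left (mul_nonneg zero_le_two (sq_nonneg _)))
  · ring
  · ring

theorem tendsto_ricciSquared_kndsMetric_const (hΛ : 0 < Λ) (he : e ≠ 0) :
    Tendsto (ricciSquared (kndsMetric a Λ M (fun _ => e)))
      (comap (Rsq a) (𝓝 0) ⊓ 𝓟 coordDomain) atTop := by
  have hd : ∀ᶠ x in comap (Rsq a) (𝓝 0) ⊓ 𝓟 coordDomain, x ∈ coordDomain :=
    mem_inf_of_right (mem_principal_self _)
  have h0 : Tendsto (Rsq a) (comap (Rsq a) (𝓝 0) ⊓ 𝓟 coordDomain) (𝓝[>] 0) :=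
    tendsto_nhdsWithin_iff.2 ⟨tendsto_comap.mono_left inf_le_left, hd.mono fun x hx => Rsq_pos hx⟩
  have h1 : Tendsto (fun x => 2 * e ^ 4 * (Rsq a x)⁻¹ ^ 4)
      (comap (Rsq a) (𝓝 0) ⊓ 𝓟 coordDomain) atTop :=
    ((tendsto_pow_atTop (by norm_num)).comp
      (tendsto_inv_nhdsGT_zero.comp h0)).const_mul_atTop (by positivity)
  exact tendsto_atTop_mono' _ (hd.mono fun x hx => ricciSquared_kndsMetric_const_ge hΛ hx) h1

/-- The horizon function of a negative mass has exactly one positive zero. -/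
theorem exists_horizon (hΛ : 0 < Λ) (he : e ≠ 0) (hμ : 0 < μ) :
    ∃ rc : ℝ, 0 < rc ∧ ∀ r, 0 < r →
      (r < rc → 0 < r ^ 2 + a ^ 2 - chargedProfile Λ (-μ) e r) ∧
      (r = rc → r ^ 2 + a ^ 2 - chargedProfile Λ (-μ) e r = 0) ∧
      (rc < r → r ^ 2 + a ^ 2 - chargedProfile Λ (-μ) e r < 0) := by
  set f : ℝ → ℝ := fun r => r ^ 2 + a ^ 2 - chargedProfile Λ (-μ) e r with hf
  have hC : 0 < a ^ 2 + e ^ 2 := by positivity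
  have hfr : ∀ r, f r = r ^ 2 + 2 * μ * r + (a ^ 2 + e ^ 2) - Λ * r ^ 4 / 3 := fun r => by
    simp only [hf, chargedProfile]
    ring
  generalize a ^ 2 + e ^ 2 = C at hC hfr
  have hcont : Continuous f := by
    simp only [funext hfr]
    fun_prop
  -- For `b ≥ 1` the lower powers are at most `b²`, so `f b ≤ b²(K - Λb²/3)`; this is nonpositive
  -- since `b` is chosen with `Λb ≥ 3K`.
  set K := 1 + 2 * μ + C with hK
  have hK0 : 0 < K := by positivity
  set b := 1 + 3 * K / Λ with hb
  have hb1 : 1 ≤ b := by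
    have : 0 ≤ 3 * K / Λ := by positivity
    linarith
  have hΛb : Λ * b = Λ + 3 * K := by
    rw [hb]
    field_simp
  have hfb : f b ≤ 0 := by
    have h1 : b ≤ b ^ 2 := by nlinarith
    have h2 : f b ≤ b ^ 2 * (K - Λ * b ^ 2 / 3) := by
      rw [hfr, hK]
      nlinarith [mul_le_mul_of_nonneg_left h1 hμ.le, mul_le_mul_of_nonneg_left (hb1.trans h1) hC.le]
    have h3 : K ≤ Λ * b ^ 2 / 3 := by nlinarith
    exact h2.trans (mul_nonpos_of_nonneg_of_nonpos (sq_nonneg b) (by linarith))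
  obtain ⟨rc, hrc, hzero⟩ := intermediate_value_Icc' (by linarith : (0 : ℝ) ≤ b) hcont.continuousOn
    (show (0 : ℝ) ∈ Set.Icc (f b) (f 0) from ⟨hfb, by rw [hfr]; simpa using hC.le⟩)
  have hpos : 0 < rc := by
    refine lt_of_le_of_ne hrc.1 fun h => ?_
    rw [← h, hfr] at hzero
    simp only [ne_eq, OfNat.ofNat_ne_zero, not_false_eq_true, zero_pow, mul_zero, zero_add,
      zero_div, sub_zero] at hzero
    exact hC.ne' hzero
  refine ⟨rc, hpos, fun r hr => ?_⟩
  -- This is `rc² f(r) - r² f(rc)` with `f(rc) = 0`, the strict decrease of `f(r)/r²` in factored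
  -- form. Positivity of the second factor uses `μ > 0`, that is, the negative mass.
  have key : rc ^ 2 * f r = (rc - r) * (2 * μ * r * rc + C * (rc + r)
      + Λ / 3 * r ^ 2 * rc ^ 2 * (rc + r)) := by
    rw [hfr] at hzero
    rw [hfr]
    linear_combination r ^ 2 * hzero
  have hfac : 0 < 2 * μ * r * rc + C * (rc + r) + Λ / 3 * r ^ 2 * rc ^ 2 * (rc + r) := by
    positivity
  refine ⟨fun h => ?_, fun h => by rw [h]; exact hzero, fun h => ?_⟩
  · exact pos_of_mul_pos_right (key ▸ mul_pos (sub_pos.2 h) hfac) (sq_nonneg rc)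
  · have := key ▸ mul_neg_of_neg_of_pos (sub_neg.2 h) hfac
    exact (pos_iff_neg_of_mul_neg this).1 (by positivity)

theorem ksMetric_inv_rr {w : ℝ → ℝ} {x : Event} (hx : x ∈ coordDomain) :
    (ksMetric a w x)⁻¹ 1 1 = - (x 1 ^ 2 + a ^ 2 - w (x 1)) * (Rsq a x)⁻¹ := by
  rw [ksMetric_inv hx]
  rfl

/-- The equatorial ray `s ↦ (u, s, π/2, φ)`. -/
def equatorialRay (u φ s : ℝ) : Event := ![u, s, Real.pi / 2, φ]

theorem equatorialRay_mem {u φ s : ℝ} (hs : 0 < s) : equatorialRay u φ s ∈ coordDomain :=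
  ⟨by simpa [equatorialRay] using hs, by simp [equatorialRay, Real.pi_pos],
    by simp [equatorialRay, Real.pi_pos]⟩

theorem hasDerivAt_equatorialRay (u φ s : ℝ) :
    HasDerivAt (equatorialRay u φ) ![0, 1, 0, 0] s := by
  rw [hasDerivAt_pi]
  intro i
  fin_cases i
  · exact hasDerivAt_const s u
  · exact hasDerivAt_id' s
  · exact hasDerivAt_const s (Real.pi / 2)
  · exact hasDerivAt_const s φ

/-- The velocity is `∂_r`, with zero acceleration in coordinates; `g_{rr}` and all `Γᵃ_{rr}` vanish
for every profile. -/
theorem isNullGeodesicOn_equatorialRay {w w' : ℝ → ℝ}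
    (hw : ∀ r, 0 < r → HasDerivAt w (w' r) r) (u φ : ℝ) :
    IsNullGeodesicOn (ksMetric a w) (equatorialRay u φ) (Set.Ioi 0) := by
  have hd : deriv (equatorialRay u φ) = fun _ => ![0, 1, 0, 0] :=
    funext fun s => (hasDerivAt_equatorialRay u φ s).deriv
  refine ⟨?_, fun s _ h => ?_, fun s _ => ?_, fun s hs A => ?_⟩
  · refine ContDiff.contDiffOn (contDiff_pi.2 fun i => ?_)
    fin_cases i
    · exact contDiff_const
    · exact contDiff_id
    · exact contDiff_const
    · exact contDiff_const
  · simpa [hd] using congrFun h 1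
  · simp [hd, Fin.sum_univ_four, ksMetric]
  · have hΓ : christoffel (ksMetric a w) A 1 1 (equatorialRay u φ s) = 0 := by
      rw [christoffel_ksMetric (equatorialRay_mem hs) (hw _ (equatorialRay_mem hs).1)]
      fin_cases A <;> rfl
    simp [hd, Fin.sum_univ_four, hΓ]

theorem tendsto_equatorialRay (u φ : ℝ) :
    Tendsto (equatorialRay u φ) (𝓝[>] 0) (comap (Rsq a) (𝓝 0) ⊓ 𝓟 coordDomain) := by
  refine tendsto_inf.2 ⟨tendsto_comap_iff.2 ?_, tendsto_principal.2 ?_⟩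
  · have h : Rsq a ∘ equatorialRay u φ = fun s => s ^ 2 := by
      funext s
      simp [Rsq, equatorialRay]
    rw [h]
    have := (continuous_pow 2 : Continuous fun s : ℝ => s ^ 2).tendsto 0
    simpa using this.mono_left nhdsWithin_le_nhds
  · filter_upwards [self_mem_nhdsWithin] with s hs using equatorialRay_mem hs

theorem isNakedSingularity_negMassMetric (hΛ : 0 < Λ) (he : e ≠ 0) (hμ : 0 < μ) :
    IsNakedSingularity a (negMassMetric a Λ μ e) := by
  rw [negMassMetric_eq]
  refine ⟨tendsto_ricciSquared_kndsMetric_const hΛ he, ?_, fun u φ => ⟨?_, ?_⟩⟩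
  · obtain ⟨rc, hrc, h⟩ := exists_horizon (a := a) hΛ he hμ
    refine ⟨rc, hrc, fun x hx => ?_⟩
    have hz := inv_pos.2 (Rsq_pos (a := a) hx)
    obtain ⟨h1, h2, h3⟩ := h _ hx.1
    rw [kndsMetric_const_eq, ksMetric_inv_rr hx]
    exact ⟨fun hlt => mul_neg_of_neg_of_pos (neg_neg_of_pos (h1 hlt)) hz,
      fun heq => by rw [h2 heq, neg_zero, zero_mul],
      fun hgt => mul_pos (neg_pos_of_neg (h3 hgt)) hz⟩
  · rw [kndsMetric_const_eq]
    exact isNullGeodesicOn_equatorialRay (fun r _ => hasDerivAt_chargedProfile r) u φ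
  · exact (tendsto_ricciSquared_kndsMetric_const hΛ he).comp (tendsto_equatorialRay u φ)

/-- The profile exceeds the de Sitter one by `2Mr - e²`, which is `-2QR²`. Nullity for both metrics
follows from `ℓᵃ = ∂_r` and `ℓ_r = 0`. -/
theorem isEmbeddedInDeSitter_kndsMetric_const :
    IsEmbeddedInDeSitter a Λ M e (kndsMetric a Λ M (fun _ => e)) := by
  have hnull : ∀ (w : ℝ → ℝ), ∀ x ∈ coordDomain,
      ∑ i, raiseIndex (ksMetric a w) x (tetradL a x) i * tetradL a x i = 0 := fun w x hx => by
    rw [raiseIndex_tetradL hx]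
    simp [Fin.sum_univ_four, tetradL]
  refine fun x hx => ⟨fun i j => ?_, ?_, ?_⟩
  · have hS := (Rsq_pos (a := a) hx).ne'
    simp only [tetradL_eq_ofReal]
    norm_cast
    rw [deSitterMetric]
    fin_cases i <;> fin_cases j <;>
      simp only [kndsMetric, DeltaStar, Fin.zero_eta, Fin.mk_one, Fin.reduceFinMk,
        Matrix.of_apply, Matrix.cons_val', Matrix.cons_val_zero, Matrix.cons_val_one,
        Matrix.cons_val, Matrix.cons_val_fin_one] <;>
      ring
  · rw [kndsMetric_const_eq]
    exact hnull _ x hx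
  · rw [deSitterMetric, kndsMetric_const_eq]
    exact hnull _ x hx

theorem negMassMetric_zero_rotation (Λ μ e : ℝ) : negMassMetric 0 Λ μ e = negMassRNMetric Λ μ e := by
  funext x
  ext i j
  -- At `r = 0` the quotients on both sides take the default value 0, so no domain restriction is
  -- needed.
  rcases eq_or_ne (x 1) 0 with h | h
  · fin_cases i <;> fin_cases j <;> simp [negMassMetric, negMassRNMetric, Rsq, h]
  · fin_cases i <;> fin_cases j <;> simp [negMassMetric, negMassRNMetric, Rsq] <;> field_simp
    ring

theorem npPsi2_negMassMetric {x : Event} (hx : x ∈ coordDomain) :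
    npPsi2 (negMassMetric a Λ μ e) (tetradL a x) (tetradN a Λ (-μ) (fun _ => e) x)
        (tetradM a x) x =
      1 / ((starRingEnd ℂ (Rcx a x)) ^ 2 * (Rsq a x : ℂ)) *
        ((μ : ℂ) * Rcx a x + (e : ℂ) ^ 2 +
          ((Λ * x 1 ^ 2 / 3 * a ^ 2 * Real.cos (x 2) ^ 2 : ℝ) : ℂ)) := by
  rw [negMassMetric_eq, npPsi2_kndsMetric_const hx]
  push_cast
  rw [neg_neg]

theorem npPsi2_negMassRNMetric {x : Event} (hx : x ∈ coordDomain) (hμ : 0 < μ) :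
    npPsi2 (negMassRNMetric Λ μ e) (tetradL 0 x) (tetradN 0 Λ (-μ) (fun _ => e) x)
        (tetradM 0 x) x = ((μ / x 1 ^ 3 * (1 + e ^ 2 / (x 1 * μ)) : ℝ) : ℂ) := by
  have hr : (x 1 : ℂ) ≠ 0 := by exact_mod_cast hx.1.ne'
  have hμ' : (μ : ℂ) ≠ 0 := by exact_mod_cast hμ.ne'
  rw [← negMassMetric_zero_rotation, npPsi2_negMassMetric hx]
  have hR : Rcx 0 x = x 1 := by simp [Rcx]
  have hS : Rsq 0 x = x 1 ^ 2 := by simp [Rsq]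
  rw [hR, hS, Complex.conj_ofReal]
  push_cast
  field_simp
  ring

end NakedSingularity

/-! ### Telescoping masses and the final assembly -/

theorem mass_sub_eq_sum (mass : ℕ → ℝ) (N n : ℕ) :
    ∑ j ∈ Finset.range n, (mass (N + j) - mass (N + j + 1)) = mass N - mass (N + n) := by
  exact Finset.sum_range_sub' (fun j => mass (N + j)) n

end

theorem theorem3 (a Λ e M : ℝ) (hΛ : 0 < Λ) (he : e ≠ 0) (hM : 0 < M) :
    -- the non-rotating case `a = 0` is the Reissner-Nordstrom-de Sitter metric
    (a = 0 → ∀ (M₀ : ℝ) (q : ℝ → ℝ), ∀ x ∈ coordDomain,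
      kndsMetric a Λ M₀ q x = rndsMetric Λ M₀ q x) ∧
    -- the vanishing of the electromagnetic Ricci scalar determines the variable charge
    (∀ (M₀ : ℝ) (q : ℝ → ℝ), ContDiffOn ℝ 2 q (Set.Ioi 0) →
      ((∀ x ∈ coordDomain, lambdaE a Λ M₀ q x = 0) ↔
        ∃ m C : ℝ, ∀ r, 0 < r → q r ^ 2 = 2 * r * m + C)) ∧
    -- every electrical radiation changes the mass, whatever the mass is, and nothing else
    (∀ (M₀ : ℝ) (q : ℝ → ℝ), IsElectricalRadiation a Λ e M₀ q →
      ∃ m : ℝ, 0 < m ∧ (∀ r, 0 < r → q r ^ 2 = 2 * r * m + e ^ 2) ∧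
        ∀ x ∈ coordDomain, kndsMetric a Λ M₀ q x = kndsMetric a Λ (M₀ - m) (fun _ => e) x) ∧
    -- radiation can go on indefinitely, with arbitrary positive amounts
    (∀ m : ℕ → ℝ, (∀ k, 0 < m k) → ∃ (mass : ℕ → ℝ) (q : ℕ → ℝ → ℝ),
      IsRadiationProcess a Λ e M mass q ∧ ∀ k, mass k = M - ∑ j ∈ Finset.range k, m j) ∧
    -- after the complete evaporation of the mass, a growing negative mass is created
    (∀ (mass : ℕ → ℝ) (q : ℕ → ℝ → ℝ), IsRadiationProcess a Λ e M mass q →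
      (∀ k, mass (k + 1) < mass k) ∧
      ∀ N, mass N = 0 →
        (∀ n, 1 ≤ n →
          0 < ∑ j ∈ Finset.range n, (mass (N + j) - mass (N + j + 1)) ∧
          ∀ x ∈ coordDomain, kndsMetric a Λ (mass (N + n)) (fun _ => e) x =
            negMassMetric a Λ (∑ j ∈ Finset.range n, (mass (N + j) - mass (N + j + 1))) e x) ∧
        (∀ μ : ℝ, HasSum (fun j => mass (N + j) - mass (N + j + 1)) μ →
          0 < μ ∧ ∀ x ∈ coordDomain,
            Tendsto (fun n => kndsMetric a Λ (mass (N + n)) (fun _ => e) x) atTop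
              (𝓝 (negMassMetric a Λ μ e x)))) ∧
    -- one and the same electromagnetic field, with the same Maxwell scalar, serves for every mass
    (∃ F : TensorField2, ∀ M₀ : ℝ,
      IsMaxwellFieldOn (kndsMetric a Λ M₀ (fun _ => e)) F coordDomain ∧
      ∀ x ∈ coordDomain,
        npPhi0 (kndsMetric a Λ M₀ (fun _ => e)) F (tetradL a x) (tetradM a x) x = 0 ∧
        npPhi1 (kndsMetric a Λ M₀ (fun _ => e)) F (tetradL a x)
          (tetradN a Λ M₀ (fun _ => e) x) (tetradM a x) x =
            (e : ℂ) / ((Real.sqrt 2 : ℂ) * (starRingEnd ℂ (Rcx a x)) ^ 2) ∧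
        npPhi2 (kndsMetric a Λ M₀ (fun _ => e)) F
          (tetradN a Λ M₀ (fun _ => e) x) (tetradM a x) x = 0 ∧
        (∀ i j, ((einsteinTensor (kndsMetric a Λ M₀ (fun _ => e)) i j x : ℝ) : ℂ) =
          - (((maxwellStress (kndsMetric a Λ M₀ (fun _ => e)) F i j x : ℝ) : ℂ)
            + cosmologicalStress a Λ M₀ (fun _ => e) i j x)) ∧
        npLambda (kndsMetric a Λ M₀ (fun _ => e)) x = lambdaC a Λ x ∧
        lambdaC a Λ x = Λ * x 1 ^ 2 / (6 * Rsq a x)) ∧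
    -- the metrics created are negative mass naked singularities embedded into de Sitter space
    (∀ μ : ℝ, 0 < μ →
      negMassMetric a Λ μ e = kndsMetric a Λ (-μ) (fun _ => e) ∧
      (∀ x ∈ coordDomain,
        npPsi2 (negMassMetric a Λ μ e) (tetradL a x) (tetradN a Λ (-μ) (fun _ => e) x)
          (tetradM a x) x =
            1 / ((starRingEnd ℂ (Rcx a x)) ^ 2 * (Rsq a x : ℂ)) *
              ((μ : ℂ) * Rcx a x + (e : ℂ) ^ 2 +
                ((Λ * x 1 ^ 2 / 3 * a ^ 2 * Real.cos (x 2) ^ 2 : ℝ) : ℂ))) ∧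
      (a = 0 → ∀ x ∈ coordDomain,
        negMassMetric a Λ μ e x = negMassRNMetric Λ μ e x ∧
        npPsi2 (negMassRNMetric Λ μ e) (tetradL a x) (tetradN a Λ (-μ) (fun _ => e) x)
          (tetradM a x) x = ((μ / x 1 ^ 3 * (1 + e ^ 2 / (x 1 * μ)) : ℝ) : ℂ)) ∧
      IsNakedSingularity a (negMassMetric a Λ μ e) ∧
      IsEmbeddedInDeSitter a Λ (-μ) e (negMassMetric a Λ μ e)) := by
  refine ⟨?_, fun M₀ q hq => lambdaE_eq_zero_iff hq, fun M₀ q hq => ?_,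
    fun m hm => exists_isRadiationProcess he hm, fun mass q h => ⟨h.mass_succ_lt he, ?_⟩,
    ⟨faradayField a e, fun M₀ => ⟨?_, fun x hx => ?_⟩⟩, fun μ hμ => ?_⟩
  · rintro rfl M₀ q x hx
    exact kndsMetric_zero_rotation Λ M₀ q hx
  · obtain ⟨m, hm, h⟩ := hq.exists_mass he
    exact ⟨m, hm, h, fun x hx => kndsMetric_eq_of_sq_eq h hx⟩
  · intro N hN
    have hlt := h.mass_succ_lt he
    -- As `mass N = 0`, the telescoped losses are exactly the negative of the later mass.
    have hmass : ∀ n, mass (N + n) = -∑ j ∈ Finset.range n, (mass (N + j) - mass (N + j + 1)) :=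
      fun n => by rw [mass_sub_eq_sum, hN, zero_sub, neg_neg]
    refine ⟨fun n hn => ⟨Finset.sum_pos (fun j _ => sub_pos.2 (hlt (N + j)))
      ⟨0, Finset.mem_range.2 hn⟩, fun x _ => ?_⟩, fun μ hμ => ⟨?_, fun x _ => ?_⟩⟩
    · rw [negMassMetric_eq, ← hmass]
    -- Comparison with the zero series, strict at the term `j = 0`.
    · exact hasSum_lt (fun j => (sub_pos.2 (hlt (N + j))).le) (sub_pos.2 (hlt (N + 0))) hasSum_zero hμ
    · rw [negMassMetric_eq]
      refine tendsto_kndsMetric_mass ?_ x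
      rw [funext hmass]
      exact hμ.tendsto_sum_nat.neg
  · rw [kndsMetric_const_eq]
    exact isMaxwellFieldOn_faradayField fun r _ => hasDerivAt_chargedProfile r
  · refine ⟨?_, ?_, ?_, einstein_kndsMetric_const hx, ?_, lambdaC_eq hx⟩
    · rw [kndsMetric_const_eq]
      exact npPhi0_faradayField hx
    · rw [kndsMetric_const_eq]
      exact npPhi1_faradayField hx deltaStar_const_eq
    · rw [kndsMetric_const_eq]
      exact npPhi2_faradayField hx deltaStar_const_eq
    · rw [lambdaC_eq hx, npLambda_kndsMetric_const hx]
  · refine ⟨negMassMetric_eq a Λ μ e, fun x hx => npPsi2_negMassMetric hx, ?_,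
      isNakedSingularity_negMassMetric hΛ he hμ, ?_⟩
    · rintro rfl x hx
      exact ⟨congrFun (negMassMetric_zero_rotation Λ μ e) x, npPsi2_negMassRNMetric hx hμ⟩
    · rw [negMassMetric_eq]
      exact isEmbeddedInDeSitter_kndsMetric_const
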